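/- **Proposition 4.6** (classification of 3-dimensional weak Hopf algebras). Let $K$ be an algebraically closed field of characteristic $0$ (for example $K=\mathbb C$). A *weak Hopf algebra* over $K$ is a $K$-vector space $H$ with a unital associative algebra structure $(m,1)$, a coassociative counital coalgebra structure $(\Delta,\varepsilon)$ and a linear map $S:H\to H$ (the antipode) such that for all $x,y,z\in H$, with $\Delta(x)=x_{(1)}\otimes x_{(2)}$: - $\Delta(xy)=\Delta(x)\Delta(y)$; - $(\Delta\otimes\mathrm{id})\Delta(1)=(\Delta(1)\otimes 1)(1\otimes\Delta(1))=(1\otimes\Delta(1))(\Delta(1)\otimes 1)$; - $\varepsilon(xyz)=\varepsilon(xy_{(1)})\,\varepsilon(y_{(2)}z)$; - $x_{(1)}S(x_{(2)})=(\varepsilon\otimes\mathrm{id})(\Delta(1)(x\otimes 1))$; - $S(x_{(1)})x_{(2)}=(\mathrm{id}\otimes\varepsilon)((1\otimes x)\Delta(1))$; - $S(x_{(1)})x_{(2)}S(x_{(3)})=S(x)$. An isomorphism of weak Hopf algebras is a linear bijection compatible with $m$, $1$, $\Delta$, $\varepsilon$ and $S$. Let $m_1^3$ be the algebra with basis $e_1,e_2,e_3$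 and multiplication $e_ie_j=e_{\max(i,j)}$ (so $e_1=1$). The following three structures on $m_1^3$ are weak Hopf algebras, and every 3-dimensional weak Hopf algebra over $K$ is isomorphic to exactly one of them. 1. $\Delta(e_1)=e_1\otimes e_1$, $\Delta(e_2)=e_1\otimes e_2+e_2\otimes e_1-e_2\otimes e_2-e_2\otimes e_3-e_3\otimes e_2+2e_3\otimes e_3$, $\Delta(e_3)=e_1\otimes e_3+e_2\otimes e_2-2e_2\otimes e_3+e_3\otimes e_1-2e_3\otimes e_2+e_3\otimes e_3$; $\varepsilon(e_1)=1$, $\varepsilon(e_2)=\varepsilon(e_3)=0$; $S(e_1)=e_1$, $S(e_2)=e_2$, $S(e_3)=e_2-e_3$. 2. $\Delta(e_1)=(e_1-e_2)\otimes(e_1-e_2)+e_2\otimes e_2$, $\Delta(e_2)=e_2\otimes e_2$, $\Delta(e_3)=(e_2-e_3)\otimes e_3+e_3\otimes(e_2-e_3)$; $\varepsilon(e_1)=2$, $\varepsilon(e_2)=1$, $\varepsilon(e_3)=0$; $S=\mathrm{id}$. 3. $\Delta(e_1)=(e_1-e_2)\otimes(e_1-e_2)+(e_2-e_3)\otimes(e_2-e_3)+e_3\otimes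 e_3$, $\Delta(e_2)=(e_2-e_3)\otimes(e_2-e_3)+e_3\otimes e_3$, $\Delta(e_3)=e_3\otimes e_3$; $\varepsilon(e_1)=3$, $\varepsilon(e_2)=2$, $\varepsilon(e_3)=1$; $S=\mathrm{id}$. -/

import Mathlib

open scoped TensorProduct

/-- A weak bialgebra over `R`: a unital associative algebra and a coalgebra, where the
comultiplication is multiplicative but need not preserve the unit, and the counit need not be
multiplicative. -/
class WeakBialgebra (R A : Type*) [CommSemiring R] [Semiring A]
    extends Algebra R A, Coalgebra R A where
  /-- `Δ(x y) = Δ(x) Δ(y)`. -/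
  comul_mul : ∀ x y : A, comul (x * y) = comul x * comul y
  /-- `(Δ ⊗ id) Δ(1) = (Δ(1) ⊗ 1) (1 ⊗ Δ(1))`. -/
  comul_one_left :
    comul.rTensor A (comul (1 : A)) =
      (comul (1 : A) ⊗ₜ[R] (1 : A)) *
        (TensorProduct.assoc R A A A).symm ((1 : A) ⊗ₜ[R] comul (1 : A))
  /-- `(Δ ⊗ id) Δ(1) = (1 ⊗ Δ(1)) (Δ(1) ⊗ 1)`. -/
  comul_one_right :
    comul.rTensor A (comul (1 : A)) =
      (TensorProduct.assoc R A A A).symm ((1 : A) ⊗ₜ[R] comul (1 : A)) *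
        (comul (1 : A) ⊗ₜ[R] (1 : A))
  /-- `ε(x y z) = ε(x y₍₁₎) ε(y₍₂₎ z)`. -/
  counit_mul_mul : ∀ x y z : A,
    counit (x * y * z) =
      LinearMap.mul' R R (TensorProduct.map counit counit
        ((x ⊗ₜ[R] (1 : A)) * comul y * ((1 : A) ⊗ₜ[R] z)))

/-- A weak Hopf algebra over `R`: a weak bialgebra with an antipode. -/
class WeakHopfAlgebra (R A : Type*) [CommSemiring R] [Semiring A]
    extends WeakBialgebra R A where
  /-- The antipode `S`. -/
  antipode (R) : A →ₗ[R] A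
  /-- `m (id ⊗ S) Δ(x) = (ε ⊗ id) (Δ(1) (x ⊗ 1))`. -/
  mul_antipode_lTensor : ∀ x : A,
    LinearMap.mul' R A (antipode.lTensor A (comul x)) =
      TensorProduct.lid R A (counit.rTensor A (comul (1 : A) * (x ⊗ₜ[R] (1 : A))))
  /-- `m (S ⊗ id) Δ(x) = (id ⊗ ε) ((1 ⊗ x) Δ(1))`. -/
  mul_antipode_rTensor : ∀ x : A,
    LinearMap.mul' R A (antipode.rTensor A (comul x)) =
      TensorProduct.rid R A (counit.lTensor A (((1 : A) ⊗ₜ[R] x) * comul (1 : A)))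
  /-- `m (m ⊗ id) (S ⊗ id ⊗ S) (Δ ⊗ id) Δ(x) = S(x)`. -/
  antipode_mul_id_mul_antipode : ∀ x : A,
    LinearMap.mul' R A ((LinearMap.mul' R A).rTensor A
      (TensorProduct.map (TensorProduct.map antipode LinearMap.id) antipode
        (comul.rTensor A (comul x)))) = antipode x

/-- An isomorphism of weak Hopf algebras: a linear bijection compatible with multiplication (hence
with units), comultiplication, counit and antipode. -/
structure WeakHopfIso (R A B : Type*) [CommSemiring R] [Semiring A] [Semiring B]
    [WeakHopfAlgebra R A] [WeakHopfAlgebra R B] extends A ≃ₐc[R] B where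
  /-- Compatibility with the antipodes. -/
  map_antipode : ∀ x : A,
    toFun (WeakHopfAlgebra.antipode R x) = WeakHopfAlgebra.antipode R (toFun x)

/-- The underlying space `K³` of the `i`-th listed weak Hopf algebra, `i = 0, 1, 2`. As an algebra
it does not depend on `i`: it is `m_1^3`, see `ListedWHA.e_mul_e` and `ListedWHA.one_eq`. -/
def ListedWHA (K : Type*) (_i : Fin 3) : Type _ := Fin 3 → K

namespace ListedWHA

theorem ext' {K : Type*} {i : Fin 3} {f g : ListedWHA K i} (h : ∀ k, f k = g k) : f = g :=
  funext h

variable {K : Type*} [Field K] {i : Fin 3}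

instance : Zero (ListedWHA K i) := inferInstanceAs (Zero (Fin 3 → K))

instance : Add (ListedWHA K i) := inferInstanceAs (Add (Fin 3 → K))

/-- The multiplication of `m_1^3`: the bilinear map with `e a * e b = e (max a b)`. -/
instance : Mul (ListedWHA K i) :=
  ⟨fun f g => fun k => ∑ a : Fin 3, ∑ b : Fin 3, if max a b = k then f a * g b else 0⟩

instance : One (ListedWHA K i) := ⟨fun k => if k = 0 then 1 else 0⟩

theorem mul_apply (f g : ListedWHA K i) (k : Fin 3) :
    (f * g) k = ∑ a : Fin 3, ∑ b : Fin 3, if max a b = k then f a * g b else 0 := rfl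

theorem one_apply (k : Fin 3) : (1 : ListedWHA K i) k = if k = 0 then 1 else 0 := rfl

theorem add_apply (f g : ListedWHA K i) (k : Fin 3) : (f + g) k = f k + g k := rfl

theorem zero_apply (k : Fin 3) : (0 : ListedWHA K i) k = 0 := rfl


instance : CommRing (ListedWHA K i) :=
  { (inferInstanceAs (AddCommGroup (Fin 3 → K)) : AddCommGroup (ListedWHA K i)) with
    mul := (· * ·)
    one := 1
    left_distrib := fun f g h => ext' fun k => by
      fin_cases k <;> simp [mul_apply, add_apply, Fin.sum_univ_three] <;> ring
    right_distrib := fun f g h => ext' fun k => by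
      fin_cases k <;> simp [mul_apply, add_apply, Fin.sum_univ_three] <;> ring
    zero_mul := fun f => ext' fun k => by simp [mul_apply, zero_apply]
    mul_zero := fun f => ext' fun k => by simp [mul_apply, zero_apply]
    mul_assoc := fun f g h => ext' fun k => by
      fin_cases k <;> simp [mul_apply, Fin.sum_univ_three] <;> ring
    one_mul := fun f => ext' fun k => by
      fin_cases k <;> simp [mul_apply, one_apply, Fin.sum_univ_three]
    mul_one := fun f => ext' fun k => by
      fin_cases k <;> simp [mul_apply, one_apply, Fin.sum_univ_three]
    mul_comm := fun f g => ext' fun k => by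
      fin_cases k <;> simp [mul_apply, Fin.sum_univ_three] <;> ring }

/-- The coordinatewise scalar multiplication of `K³`. -/
abbrev moduleAux : Module K (ListedWHA K i) :=
  inferInstanceAs (Module K (Fin 3 → K))

instance : Algebra K (ListedWHA K i) :=
  letI : Module K (ListedWHA K i) := moduleAux
  have hs (c : K) (f : ListedWHA K i) (k : Fin 3) : (c • f) k = c * f k := rfl
  Algebra.ofModule
    (fun c f g => ext' fun k => by
      fin_cases k <;> simp [mul_apply, hs, Fin.sum_univ_three] <;> ring)
    (fun c f g => ext' fun k => by
      fin_cases k <;> simp [mul_apply, hs, Fin.sum_univ_three] <;> ring)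

variable (K i) in
/-- The standard basis of `K³`. The vectors `e 0`, `e 1`, `e 2` are the usual `e₁`, `e₂`, `e₃`. -/
noncomputable def e : Module.Basis (Fin 3) K (ListedWHA K i) := Pi.basisFun K (Fin 3)

theorem e_apply (a k : Fin 3) : (e K i a : ListedWHA K i) k = if k = a then 1 else 0 := by
  change (Pi.basisFun K (Fin 3) a) k = _
  simp [Pi.single_apply]

theorem one_eq : (1 : ListedWHA K i) = e K i 0 :=
  ext' fun k => by rw [one_apply, e_apply]

theorem e_mul_e (a b : Fin 3) : e K i a * e K i b = e K i (max a b) :=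
  ext' fun k => by
    fin_cases a <;> fin_cases b <;> fin_cases k <;>
      simp [mul_apply, e_apply, Fin.sum_univ_three]

theorem finrank_eq : Module.finrank K (ListedWHA K i) = 3 := by
  simp [Module.finrank_eq_card_basis (e K i)]

variable (K i) in
/-- The values `Δ(e₁), Δ(e₂), Δ(e₃)` of the three comultiplications. -/
noncomputable def comulTable : Fin 3 → ListedWHA K i ⊗[K] ListedWHA K i :=
  let e₁ := e K i 0
  let e₂ := e K i 1
  let e₃ := e K i 2
  match i with
  | 0 =>
    ![e₁ ⊗ₜ[K] e₁,
      e₁ ⊗ₜ[K] e₂ + e₂ ⊗ₜ[K] e₁ - e₂ ⊗ₜ[K] e₂ - e₂ ⊗ₜ[K] e₃ - e₃ ⊗ₜ[K] e₂ + (2 : K) • (e₃ ⊗ₜ[K] e₃),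
      e₁ ⊗ₜ[K] e₃ + e₂ ⊗ₜ[K] e₂ - (2 : K) • (e₂ ⊗ₜ[K] e₃) + e₃ ⊗ₜ[K] e₁ - (2 : K) • (e₃ ⊗ₜ[K] e₂) + e₃ ⊗ₜ[K] e₃]
  | 1 =>
    ![(e₁ - e₂) ⊗ₜ[K] (e₁ - e₂) + e₂ ⊗ₜ[K] e₂,
      e₂ ⊗ₜ[K] e₂,
      (e₂ - e₃) ⊗ₜ[K] e₃ + e₃ ⊗ₜ[K] (e₂ - e₃)]
  | 2 =>
    ![(e₁ - e₂) ⊗ₜ[K] (e₁ - e₂) + (e₂ - e₃) ⊗ₜ[K] (e₂ - e₃) + e₃ ⊗ₜ[K] e₃,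
      (e₂ - e₃) ⊗ₜ[K] (e₂ - e₃) + e₃ ⊗ₜ[K] e₃,
      e₃ ⊗ₜ[K] e₃]

variable (K i) in
/-- The values `ε(e₁), ε(e₂), ε(e₃)` of the three counits. -/
def counitTable : Fin 3 → K :=
  match i with
  | 0 => ![1, 0, 0]
  | 1 => ![2, 1, 0]
  | 2 => ![3, 2, 1]

variable (K i) in
/-- The values `S(e₁), S(e₂), S(e₃)` of the three antipodes. -/
noncomputable def antipodeTable : Fin 3 → ListedWHA K i :=
  let e₁ := e K i 0
  let e₂ := e K i 1
  let e₃ := e K i 2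
  match i with
  | 0 => ![e₁, e₂, e₂ - e₃]
  | 1 => ![e₁, e₂, e₃]
  | 2 => ![e₁, e₂, e₃]

noncomputable instance : CoalgebraStruct K (ListedWHA K i) where
  comul := (e K i).constr K (comulTable K i)
  counit := (e K i).constr K (counitTable K i)

theorem comul_e (a : Fin 3) :
    CoalgebraStruct.comul (R := K) (e K i a) = comulTable K i a :=
  (e K i).constr_basis K _ a

theorem counit_e (a : Fin 3) :
    CoalgebraStruct.counit (R := K) (e K i a) = counitTable K i a :=
  (e K i).constr_basis K _ a

variable (K i) in
/-- The orthogonal idempotents `e₁ - e₂, e₂ - e₃, e₃`, used only to verify the axioms. -/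
noncomputable def d : Fin 3 → ListedWHA K i :=
  ![e K i 0 - e K i 1, e K i 1 - e K i 2, e K i 2]

theorem e_zero : e K i 0 = d K i 0 + d K i 1 + d K i 2 := by simp [d]

theorem e_one : e K i 1 = d K i 1 + d K i 2 := by simp [d]

theorem e_two : e K i 2 = d K i 2 := by simp [d]

theorem d_mul_d (a b : Fin 3) : d K i a * d K i b = if a = b then d K i a else 0 := by
  fin_cases a <;> fin_cases b <;> simp [d, mul_sub, sub_mul, e_mul_e]

theorem one_eq_d : (1 : ListedWHA K i) = d K i 0 + d K i 1 + d K i 2 := by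
  rw [one_eq, e_zero]

theorem induction_d {P : ListedWHA K i → Prop} (hd : ∀ a, P (d K i a))
    (hadd : ∀ x y, P x → P y → P (x + y)) (hsmul : ∀ (c : K) x, P x → P (c • x)) :
    ∀ x, P x := by
  intro x
  have he : ∀ a, P (e K i a) := by
    intro a
    fin_cases a
    · simpa [e_zero] using hadd _ _ (hadd _ _ (hd 0) (hd 1)) (hd 2)
    · simpa [e_one] using hadd _ _ (hd 1) (hd 2)
    · simpa [e_two] using hd 2
  rw [← (e K i).sum_repr x, Fin.sum_univ_three]
  exact hadd _ _ (hadd _ _ (hsmul _ _ (he 0)) (hsmul _ _ (he 1))) (hsmul _ _ (he 2))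

variable (K i) in
/-- The values of the three comultiplications on the idempotents. -/
noncomputable def comulTableD : Fin 3 → ListedWHA K i ⊗[K] ListedWHA K i :=
  let p := d K i 0
  let q := d K i 1
  let r := d K i 2
  match i with
  | 0 =>
    ![p ⊗ₜ[K] p + q ⊗ₜ[K] r + r ⊗ₜ[K] q, p ⊗ₜ[K] q + q ⊗ₜ[K] p + r ⊗ₜ[K] r,
      p ⊗ₜ[K] r + r ⊗ₜ[K] p + q ⊗ₜ[K] q]
  | 1 => ![p ⊗ₜ[K] p, q ⊗ₜ[K] q + r ⊗ₜ[K] r, q ⊗ₜ[K] r + r ⊗ₜ[K] q]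
  | 2 => ![p ⊗ₜ[K] p, q ⊗ₜ[K] q, r ⊗ₜ[K] r]

theorem comul_d (a : Fin 3) :
    CoalgebraStruct.comul (R := K) (d K i a) = comulTableD K i a := by
  fin_cases i <;> fin_cases a <;>
    simp only [d, Fin.zero_eta, Fin.mk_one, Fin.reduceFinMk, Matrix.cons_val, map_sub, comul_e,
      comulTable, comulTableD, TensorProduct.tmul_sub, TensorProduct.sub_tmul, two_smul] <;> abel

variable (K i) in
/-- The values of the three counits on the idempotents. -/
def counitTableD : Fin 3 → K :=
  match i with
  | 0 => ![1, 0, 0]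
  | 1 => ![1, 1, 0]
  | 2 => ![1, 1, 1]

theorem counit_d (a : Fin 3) :
    CoalgebraStruct.counit (R := K) (d K i a) = counitTableD K i a := by
  fin_cases i <;> fin_cases a <;>
    simp [d, counit_e, counitTable, counitTableD] <;> norm_num

noncomputable instance : Coalgebra K (ListedWHA K i) where
  coassoc := by
    refine LinearMap.ext (induction_d (fun a => ?_) ?_ ?_)
    · fin_cases i <;> fin_cases a <;>
        simp [comul_d, comulTableD, TensorProduct.tmul_add, TensorProduct.add_tmul] <;> abel
    · intro x y hx hy; rw [map_add, map_add, hx, hy]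
    · intro c x hx; rw [map_smul, map_smul, hx]
  rTensor_counit_comp_comul := by
    refine LinearMap.ext (induction_d (fun a => ?_) ?_ ?_)
    · fin_cases i <;> fin_cases a <;>
        simp [comul_d, comulTableD, counit_d, counitTableD]
    · intro x y hx hy; rw [map_add, map_add, hx, hy]
    · intro c x hx; rw [map_smul, map_smul, hx]
  lTensor_counit_comp_comul := by
    refine LinearMap.ext (induction_d (fun a => ?_) ?_ ?_)
    · fin_cases i <;> fin_cases a <;>
        simp [comul_d, comulTableD, counit_d, counitTableD]
    · intro x y hx hy; rw [map_add, map_add, hx, hy]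
    · intro c x hx; rw [map_smul, map_smul, hx]

variable (K i) in
/-- The antipode with the values `antipodeTable` on the basis. -/
noncomputable def antipodeMap : ListedWHA K i →ₗ[K] ListedWHA K i :=
  (e K i).constr K (antipodeTable K i)

variable (K i) in
/-- The values of the three antipodes on the idempotents. -/
noncomputable def antipodeTableD : Fin 3 → ListedWHA K i :=
  match i with
  | 0 => ![d K 0 0, d K 0 2, d K 0 1]
  | 1 => ![d K 1 0, d K 1 1, d K 1 2]
  | 2 => ![d K 2 0, d K 2 1, d K 2 2]

theorem antipode_e (a : Fin 3) : antipodeMap K i (e K i a) = antipodeTable K i a :=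
  (e K i).constr_basis K _ a

theorem antipode_d (a : Fin 3) : antipodeMap K i (d K i a) = antipodeTableD K i a := by
  fin_cases i <;> fin_cases a <;>
    simp [d, antipode_e, antipodeTable, antipodeTableD]

theorem comul_mul_aux (x y : ListedWHA K i) :
    CoalgebraStruct.comul (R := K) (x * y) =
      CoalgebraStruct.comul (R := K) x * CoalgebraStruct.comul (R := K) y := by
  revert x y
  refine induction_d (fun a => ?_) ?_ ?_
  · refine induction_d (fun b => ?_) ?_ ?_
    · fin_cases i <;> fin_cases a <;> fin_cases b <;>
        simp [comul_d, comulTableD, d_mul_d, mul_add, add_mul]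
    · intro x y hx hy; rw [mul_add, map_add, hx, hy, map_add, mul_add]
    · intro c x hx; rw [mul_smul_comm, map_smul, hx, map_smul, mul_smul_comm]
  · intro x y hx hy z; rw [add_mul, map_add, hx, hy, map_add, add_mul]
  · intro c x hx z; rw [smul_mul_assoc, map_smul, hx, map_smul, smul_mul_assoc]

theorem comul_one_aux :
    (CoalgebraStruct.comul (R := K)).rTensor (ListedWHA K i)
        (CoalgebraStruct.comul (R := K) (1 : ListedWHA K i)) =
      (CoalgebraStruct.comul (R := K) (1 : ListedWHA K i) ⊗ₜ[K] (1 : ListedWHA K i)) *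
        (TensorProduct.assoc K _ _ _).symm
          ((1 : ListedWHA K i) ⊗ₜ[K] CoalgebraStruct.comul (R := K) (1 : ListedWHA K i)) := by
  have h0 : CoalgebraStruct.comul (R := K) (1 : ListedWHA K 0) = 1 ⊗ₜ[K] 1 := by
    rw [one_eq, comul_e]; rfl
  have h1 : CoalgebraStruct.comul (R := K) (1 : ListedWHA K 1) =
      d K 1 0 ⊗ₜ[K] d K 1 0 + e K 1 1 ⊗ₜ[K] e K 1 1 := by
    rw [one_eq, comul_e]; rfl
  have h1d : CoalgebraStruct.comul (R := K) (d K 1 0) = d K 1 0 ⊗ₜ[K] d K 1 0 := by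
    rw [comul_d]; rfl
  have h1e : CoalgebraStruct.comul (R := K) (e K 1 1) = e K 1 1 ⊗ₜ[K] e K 1 1 := by
    rw [comul_e]; rfl
  have h1de : d K 1 0 * e K 1 1 = 0 := by simp [e_one, mul_add, d_mul_d]
  have h1one : (1 : ListedWHA K 1) = d K 1 0 + e K 1 1 := by simp [one_eq, d]
  fin_cases i
  · simp [h0]
  · simp only [Fin.mk_one, h1]
    rw [h1one]
    simp [h1d, h1e, h1de, mul_comm (e K 1 1), d_mul_d, e_mul_e, mul_add, add_mul,
      TensorProduct.tmul_add, TensorProduct.add_tmul]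
  · simp [one_eq_d, comul_d, comulTableD, d_mul_d, mul_add, add_mul, TensorProduct.tmul_add,
      TensorProduct.add_tmul]

theorem counit_aux (x y z : ListedWHA K i) :
    CoalgebraStruct.counit (R := K) (x * y * z) =
      LinearMap.mul' K K (TensorProduct.map (CoalgebraStruct.counit (R := K))
        (CoalgebraStruct.counit (R := K))
        ((x ⊗ₜ[K] (1 : ListedWHA K i)) * CoalgebraStruct.comul (R := K) y *
          ((1 : ListedWHA K i) ⊗ₜ[K] z))) := by
  revert x y z
  refine induction_d (fun a => ?_) ?_ ?_
  · refine induction_d (fun b => ?_) ?_ ?_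
    · refine induction_d (fun c => ?_) ?_ ?_
      · fin_cases i <;> fin_cases a <;> fin_cases b <;> fin_cases c <;>
          simp [comul_d, comulTableD, d_mul_d, mul_add, counit_d, counitTableD]
      · intro x y hx hy
        simp only [mul_add, map_add, hx, hy, TensorProduct.tmul_add]
      · intro c x hx
        simp only [mul_smul_comm, map_smul, hx, TensorProduct.tmul_smul]
    · intro x y hx hy z
      simp only [mul_add, add_mul, map_add, hx, hy]
    · intro c x hx z
      simp only [mul_smul_comm, smul_mul_assoc, map_smul, hx]
  · intro x y hx hy z w
    simp only [add_mul, map_add, hx, hy, TensorProduct.add_tmul]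
  · intro c x hx z w
    simp only [smul_mul_assoc, map_smul, hx, ← TensorProduct.smul_tmul']

/-- The three listed structures are weak Hopf algebras. -/
noncomputable instance : WeakHopfAlgebra K (ListedWHA K i) where
  comul_mul := comul_mul_aux
  comul_one_left := comul_one_aux
  comul_one_right := by rw [comul_one_aux, mul_comm]
  counit_mul_mul := counit_aux
  antipode := antipodeMap K i
  mul_antipode_lTensor := by
    refine induction_d (fun a => ?_) ?_ ?_
    · fin_cases i <;> fin_cases a <;>
        simp [one_eq_d, comul_d, comulTableD, d_mul_d, add_mul, mul_add,
          TensorProduct.tmul_add, counit_d, counitTableD, antipode_d, antipodeTableD] <;> abel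
    · intro x y hx hy
      simp only [map_add, hx, hy, TensorProduct.add_tmul, mul_add]
    · intro c x hx
      simp only [map_smul, hx, ← TensorProduct.smul_tmul', mul_smul_comm]
  mul_antipode_rTensor := by
    refine induction_d (fun a => ?_) ?_ ?_
    · fin_cases i <;> fin_cases a <;>
        simp [one_eq_d, comul_d, comulTableD, d_mul_d, add_mul, mul_add,
          TensorProduct.add_tmul, counit_d, counitTableD, antipode_d, antipodeTableD] <;> abel
    · intro x y hx hy
      simp only [map_add, hx, hy, TensorProduct.tmul_add, add_mul]
    · intro c x hx
      simp only [map_smul, hx, TensorProduct.tmul_smul, smul_mul_assoc]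
  antipode_mul_id_mul_antipode := by
    refine induction_d (fun a => ?_) ?_ ?_
    · fin_cases i <;> fin_cases a <;>
        simp [comul_d, comulTableD, d_mul_d, TensorProduct.add_tmul, antipode_d,
          antipodeTableD]
    · intro x y hx hy
      simp only [map_add, hx, hy]
    · intro c x hx
      simp only [map_smul, hx]

theorem antipode_eq (a : Fin 3) :
    WeakHopfAlgebra.antipode K (e K i a) = antipodeTable K i a :=
  antipode_e a

end ListedWHA

/-! The argument takes place in the dual of `H` with the convolution product, whose unit is `ε`. As
`Δ` is multiplicative, a convolution product of two characters of `H` is again multiplicative, hence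
is zero or a character (`mul_eq_zero_or_exists`). Suppose that `ε` is a combination of the
characters. Weak multiplicativity of `ε` then forces its coefficients to be 0 or 1, and the
characters with coefficient 1 are orthogonal idempotents (`smul_conv_smul`, `coeff_eq_zero_or_one`)
serving as local units for all the others (`exists_left_unit`, `exists_right_unit`). The antipode
provides inverses, so the characters behave like the arrows of a finite groupoid.

In dimension at most 3 every simple factor of `H` modulo its radical is `K`, so this quotient is
`K^n` with `n ≤ 3`, and `n = 0` is impossible. If `n = 1`, then `ε` is the unique character. Any
functional `f` that kills `1` and the square of the radical is a derivation relative to `ε`, so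
contraction with `f` is a derivation of `H`; in characteristic zero such a derivation is
incompatible with a nonzero nilpotent radical (`eq_bot_of_local`). If `n = 2`, the radical is a line
and its dual coordinate is skew-primitive. First `ε` vanishes on the radical, so the groupoid
picture applies, and both one and two identities lead to contradictions (`not_isTwoCharSystem`).

If `n = 3`, then `H` is the algebra of functions on a groupoid with three arrows: the cyclic group
of order 3, the group of order 2 next to a trivial one, or three trivial ones. The table of the
arrows gives `Δ` on the idempotents (`comul_basis`). The antipode is determined by the remaining
structure, because it is a generalized inverse of the identity under convolution
(`map_antipode_of_bialgEquiv`). The number of identities is `ε(1)`, which separates the three types.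
-/

namespace WeakHopfAlgebra

open LinearMap WithConv

/-! ### Convolution of functionals and the weak Hopf axioms in the dual -/

section Convolution

variable {K H : Type*} [Field K] [Ring H] [WeakHopfAlgebra K H]

/-- If `l` and `m` have two-term coproducts in the dual, then so does their convolution product,
with four terms. -/
theorem conv_mul_apply {l m l₁ l₁' l₂ l₂' m₁ m₁' m₂ m₂' : WithConv (H →ₗ[K] K)}
    (hl : ∀ a b, l (a * b) = l₁ a * l₁' b + l₂ a * l₂' b)
    (hm : ∀ a b, m (a * b) = m₁ a * m₁' b + m₂ a * m₂' b) (a b : H) :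
    (l * m) (a * b) = (l₁ * m₁) a * (l₁' * m₁') b + (l₁ * m₂) a * (l₁' * m₂') b +
      (l₂ * m₁) a * (l₂' * m₁') b + (l₂ * m₂) a * (l₂' * m₂') b := by
  simp only [convMul_apply, WeakBialgebra.comul_mul]
  generalize Coalgebra.comul (R := K) a = s
  generalize Coalgebra.comul (R := K) b = t
  induction s with
  | zero => simp
  | add s s' h h' => simp only [add_mul, map_add, h, h']; ring
  | tmul x y =>
    induction t with
    | zero => simp
    | add s s' h h' => simp only [mul_add, map_add, h, h']; ring
    | tmul z w =>
      simp only [Algebra.TensorProduct.tmul_mul_tmul, TensorProduct.map_tmul, mul'_apply, hl, hm]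
      ring

/-- Weak multiplicativity of `ε` read in the dual algebra: one-sided translates of `ε` multiply to a
two-sided translate. Every later use of that axiom goes through this form. -/
theorem conv_counit_apply {l m : WithConv (H →ₗ[K] K)} {x z : H}
    (hl : ∀ y, l y = (1 : WithConv (H →ₗ[K] K)) (x * y))
    (hm : ∀ y, m y = (1 : WithConv (H →ₗ[K] K)) (y * z)) (y : H) :
    (l * m) y = (1 : WithConv (H →ₗ[K] K)) (x * y * z) := by
  simp only [convMul_apply, convOne_apply, Algebra.algebraMap_self, RingHom.id_apply,
    WeakBialgebra.counit_mul_mul] at hl hm ⊢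
  generalize Coalgebra.comul (R := K) y = s
  induction s with
  | zero => simp
  | add s s' h h' => simp only [add_mul, mul_add, map_add, h, h']
  | tmul a b => simp [hl, hm]

/-- `χ(x₍₁₎) χ(S x₍₂₎) = ε(1₍₁₎ x) χ(1₍₂₎)` for multiplicative `χ`. -/
theorem conv_antipode_apply {X l : WithConv (H →ₗ[K] K)} (hX : ∀ a b, X (a * b) = X a * X b)
    {y : H} (hl : ∀ a, l a = (1 : WithConv (H →ₗ[K] K)) (a * y)) :
    (X * toConv (X.ofConv ∘ₗ antipode K)) y = (l * X) 1 := by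
  have h1 : ∀ s : H ⊗[K] H, mul' K K (TensorProduct.map X.ofConv (X.ofConv ∘ₗ antipode K) s) =
      X (mul' K H ((antipode K).lTensor H s)) := by
    intro s
    induction s with
    | zero => simp
    | add s s' h h' => simp only [map_add, h, h']
    | tmul a b => simp [hX]
  have h2 : ∀ s : H ⊗[K] H, mul' K K (TensorProduct.map l.ofConv X.ofConv s) =
      X (TensorProduct.lid K H ((Coalgebra.counit (R := K)).rTensor H (s * (y ⊗ₜ[K] 1)))) := by
    intro s
    induction s with
    | zero => simp
    | add s s' h h' => simp only [map_add, add_mul, h, h']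
    | tmul a b => simp [hl]
  simp only [convMul_apply, h1, h2, mul_antipode_lTensor]

/-- The convolution `x ↦ f(x₍₁₎) x₍₂₎`. -/
noncomputable def leftContract (f : WithConv (H →ₗ[K] K)) : H →ₗ[K] H :=
  (TensorProduct.lid K H).toLinearMap ∘ₗ f.ofConv.rTensor H ∘ₗ Coalgebra.comul

/-- This is `f * ε = f`. It recovers `f` from the operator built from it. -/
theorem counit_leftContract (f : WithConv (H →ₗ[K] K)) (x : H) :
    (1 : WithConv (H →ₗ[K] K)) (leftContract f x) = f x := by
  have h : ∀ s : H ⊗[K] H,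
      (1 : WithConv (H →ₗ[K] K)) (TensorProduct.lid K H (f.ofConv.rTensor H s)) =
      mul' K K (TensorProduct.map f.ofConv (1 : WithConv (H →ₗ[K] K)).ofConv s) := by
    intro s
    induction s with
    | zero => simp
    | add s s' h h' => simp only [map_add, h, h']
    | tmul a b => simp
  rw [← mul_one f, convMul_apply, ← h, mul_one]
  rfl

/-- `Δ` is multiplicative and contraction with `ε` is the identity, so the Leibniz rule passes from
the functional to an honest derivation of `H`. -/
theorem leftContract_mul {f : WithConv (H →ₗ[K] K)}
    (hf : ∀ a b, f (a * b) = (1 : WithConv (H →ₗ[K] K)) a * f b +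
      f a * (1 : WithConv (H →ₗ[K] K)) b) (a b : H) :
    leftContract f (a * b) = a * leftContract f b + leftContract f a * b := by
  have key : ∀ s t : H ⊗[K] H, TensorProduct.lid K H (f.ofConv.rTensor H (s * t)) =
      TensorProduct.lid K H ((Coalgebra.counit (R := K)).rTensor H s) *
        TensorProduct.lid K H (f.ofConv.rTensor H t) +
      TensorProduct.lid K H (f.ofConv.rTensor H s) *
        TensorProduct.lid K H ((Coalgebra.counit (R := K)).rTensor H t) := by
    intro s t
    induction s with
    | zero => simp
    | add s s' h h' => simp only [add_mul, map_add, h, h']; abel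
    | tmul x y =>
      induction t with
      | zero => simp
      | add s s' h h' => simp only [mul_add, map_add, h, h']; abel
      | tmul z w =>
        simp [hf, add_smul, mul_smul]
        module
  simp [leftContract, WeakBialgebra.comul_mul, key]

end Convolution

/-! ### Characters of a basic algebra and their partial groupoid structure -/

/-- A finite family of multiplicative functionals, with a dual family of elements, such that the
common kernel consists of nilpotent elements. -/
structure IsCharSystem {K H ι : Type*} [Field K] [Ring H] [Algebra K H] [DecidableEq ι]
    (X : ι → WithConv (H →ₗ[K] K)) (d : ι → H) : Prop where
  map_mul : ∀ i a b, X i (a * b) = X i a * X i b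
  map_dual : ∀ i j, X i (d j) = if i = j then 1 else 0
  isNilpotent : ∀ z, (∀ i, X i z = 0) → IsNilpotent z

namespace IsCharSystem

section Algebra

variable {K H ι : Type*} [Field K] [Ring H] [Algebra K H] [DecidableEq ι]
  {X : ι → WithConv (H →ₗ[K] K)} {d : ι → H}

theorem map_one (hX : IsCharSystem X d) (i : ι) : X i 1 = 1 := by
  have h := hX.map_mul i 1 (d i)
  rw [one_mul, hX.map_dual, if_pos rfl, mul_one] at h
  exact h.symm

theorem ne_zero (hX : IsCharSystem X d) (i : ι) : X i ≠ 0 := fun h => by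
  have := hX.map_one i
  simp [h] at this

theorem injective (hX : IsCharSystem X d) : Function.Injective X := fun i j h => by
  by_contra hne
  have := hX.map_dual i j
  rw [h, hX.map_dual, if_pos rfl, if_neg hne] at this
  exact one_ne_zero this

variable [Fintype ι]

/-- The value of a multiplicative functional is determined by its values at the dual elements. -/
theorem apply_eq_sum (hX : IsCharSystem X d) {g : WithConv (H →ₗ[K] K)}
    (hg : ∀ a b, g (a * b) = g a * g b) (y : H) : g y = ∑ i, g (d i) * X i y := by
  have hnil : ∀ z, IsNilpotent z → g z = 0 := by
    rintro z ⟨n, hn⟩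
    -- Exponents start at 1, since `g 1 = 1` fails when `g` is zero.
    have h : ∀ k, g (z ^ (k + 1)) = g z ^ (k + 1) := by
      intro k
      induction k with
      | zero => simp
      | succ k ih => rw [pow_succ, hg, ih, pow_succ (g z) (k + 1)]
    have h0 : g (z ^ (n + 1)) = 0 := by rw [pow_succ, hn, zero_mul, map_zero]
    rw [h] at h0
    exact pow_eq_zero_iff (Nat.succ_ne_zero n) |>.1 h0
  have hz := hnil (y - ∑ i, X i y • d i) (hX.isNilpotent _ fun j => by
    simp [hX.map_dual])
  rw [map_sub, sub_eq_zero, map_sum] at hz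
  rw [hz]
  exact Finset.sum_congr rfl fun i _ => by rw [map_smul, smul_eq_mul, mul_comm]

/-- A multiplicative functional is zero or a member of the system. -/
theorem eq_zero_or_exists (hX : IsCharSystem X d) {g : WithConv (H →ₗ[K] K)}
    (hg : ∀ a b, g (a * b) = g a * g b) : g = 0 ∨ ∃ i, g = X i := by
  have hsum := hX.apply_eq_sum hg
  by_cases h0 : ∀ i, g (d i) = 0
  · left
    ext y
    rw [hsum y]
    simp [h0]
  · right
    push Not at h0
    obtain ⟨i, hi⟩ := h0
    -- The dual elements need not be orthogonal idempotents, but their products look so to every `X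
    -- k`, and `g` only sees the values of the `X k`.
    have hprod : ∀ j, g (d i) * g (d j) = if j = i then g (d i) else 0 := by
      intro j
      rw [← hg, hsum]
      rw [Finset.sum_eq_single i]
      · rw [hX.map_mul, hX.map_dual, hX.map_dual]
        by_cases h : i = j <;> simp [h, eq_comm]
      · intro k _ hk
        rw [hX.map_mul, hX.map_dual k i, if_neg hk]; simp
      · simp
    refine ⟨i, ?_⟩
    ext y
    have h1 : g (d i) = 1 := by
      have := hprod i
      rw [if_pos rfl] at this
      exact mul_left_cancel₀ hi (by rw [this, mul_one])
    have h2 : ∀ j, j ≠ i → g (d j) = 0 := fun j hj => by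
      have := hprod j
      rw [if_neg hj, h1, one_mul] at this
      exact this
    rw [hsum y, Finset.sum_eq_single i (fun j _ hj => by rw [h2 j hj, zero_mul]) (by simp), h1,
      one_mul]

end Algebra

section Dual

variable {K H ι : Type*} [Field K] [Ring H] [WeakHopfAlgebra K H] [DecidableEq ι]
  {X : ι → WithConv (H →ₗ[K] K)} {d : ι → H}

theorem mul_map_mul (hX : IsCharSystem X d) (i j : ι) (a b : H) :
    (X i * X j) (a * b) = (X i * X j) a * (X i * X j) b := by
  have h := conv_mul_apply (l := X i) (m := X j) (l₁ := X i) (l₁' := X i) (l₂ := 0) (l₂' := 0)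
    (m₁ := X j) (m₁' := X j) (m₂ := 0) (m₂' := 0) (by simp [hX.map_mul]) (by simp [hX.map_mul]) a b
  simpa using h

variable [Fintype ι]

theorem mul_eq_zero_or_exists (hX : IsCharSystem X d) (i j : ι) :
    X i * X j = 0 ∨ ∃ k, X i * X j = X k :=
  hX.eq_zero_or_exists (hX.mul_map_mul i j)

variable {α : ι → K}

/-- Each `α i • X i` is the translate of `ε` by `d i`, on either side. The product of two of them is
therefore `y ↦ ε(d i * y * d j)`, which the characters evaluate at once. -/
theorem smul_conv_smul (hX : IsCharSystem X d)
    (hα : (1 : WithConv (H →ₗ[K] K)) = ∑ i, α i • X i) (i j : ι) :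
    (α i • X i) * (α j • X j) = if i = j then α i • X i else 0 := by
  ext y
  rw [conv_counit_apply (x := d i) (z := d j)]
  · rw [hα]
    by_cases h : i = j
    · subst h
      simp [hX.map_mul, hX.map_dual]
    · simp only [ofConv_sum, ofConv_smul, LinearMap.sum_apply, LinearMap.smul_apply, hX.map_mul,
        hX.map_dual, if_neg h]
      rw [Finset.sum_eq_zero]
      · simp
      · intro k _
        by_cases hk : k = i
        · subst hk; simp [h]
        · simp [hk]
  · intro y
    rw [hα]
    simp [hX.map_mul, hX.map_dual]
  · intro y
    rw [hα]
    simp [hX.map_mul, hX.map_dual]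

/-- A nonzero coefficient cancels once from the idempotency of `α i • X i`. What remains equates a
multiple of `X i * X i`, itself zero or a character, with `X i`; evaluation at `1` fixes the scalar.
-/
theorem coeff_eq_zero_or_one (hX : IsCharSystem X d)
    (hα : (1 : WithConv (H →ₗ[K] K)) = ∑ i, α i • X i) (i : ι) :
    α i = 0 ∨ α i = 1 ∧ X i * X i = X i := by
  by_cases h0 : α i = 0
  · exact Or.inl h0
  · right
    have h := hX.smul_conv_smul hα i i
    rw [if_pos rfl, smul_mul_smul_comm, mul_smul] at h
    have h' := smul_right_injective _ h0 h
    rcases hX.mul_eq_zero_or_exists i i with hz | ⟨k, hk⟩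
    · rw [hz, smul_zero] at h'
      exact absurd h'.symm (hX.ne_zero i)
    · rw [hk] at h' ⊢
      have h1 := congrArg (fun g : WithConv (H →ₗ[K] K) => g 1) h'
      simp only [ofConv_smul, LinearMap.smul_apply, hX.map_one, smul_eq_mul, mul_one] at h1
      refine ⟨h1, ?_⟩
      rw [h1, one_smul] at h'
      exact h'

theorem mul_eq_zero_of_ne (hX : IsCharSystem X d)
    (hα : (1 : WithConv (H →ₗ[K] K)) = ∑ i, α i • X i) {i j : ι} (hij : i ≠ j) (hi : α i ≠ 0)
    (hj : α j ≠ 0) : X i * X j = 0 := by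
  have h := hX.smul_conv_smul hα i j
  rw [if_neg hij, smul_mul_smul_comm] at h
  exact (smul_eq_zero.1 h).resolve_left (mul_ne_zero hi hj)

/-- Expand `ε * X i = X i` and evaluate at `d i`: some summand is nonzero there, and the only
character not vanishing at `d i` is `X i`. -/
theorem exists_left_unit (hX : IsCharSystem X d)
    (hα : (1 : WithConv (H →ₗ[K] K)) = ∑ i, α i • X i) (i : ι) :
    ∃ k, α k = 1 ∧ X k * X i = X i := by
  have h := one_mul (X i)
  rw [hα, Finset.sum_mul] at h
  have h1 := congrArg (fun g : WithConv (H →ₗ[K] K) => g (d i)) h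
  simp only [ofConv_sum, LinearMap.sum_apply, hX.map_dual, if_true, smul_mul_assoc, ofConv_smul,
    LinearMap.smul_apply] at h1
  obtain ⟨k, -, hk⟩ := Finset.exists_ne_zero_of_sum_ne_zero (h1.trans_ne one_ne_zero)
  obtain ⟨h2, h3⟩ := smul_ne_zero_iff.1 hk
  refine ⟨k, ((hX.coeff_eq_zero_or_one hα k).resolve_left h2).1, ?_⟩
  rcases hX.mul_eq_zero_or_exists k i with hz | ⟨l, hl⟩
  · simp [hz] at h3
  · rw [hl, hX.map_dual] at h3
    rw [hl, ← of_not_not fun hne => h3 (if_neg hne)]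

theorem exists_right_unit (hX : IsCharSystem X d)
    (hα : (1 : WithConv (H →ₗ[K] K)) = ∑ i, α i • X i) (i : ι) :
    ∃ k, α k = 1 ∧ X i * X k = X i := by
  have h := mul_one (X i)
  rw [hα, Finset.mul_sum] at h
  have h1 := congrArg (fun g : WithConv (H →ₗ[K] K) => g (d i)) h
  simp only [ofConv_sum, LinearMap.sum_apply, hX.map_dual, if_true, mul_smul_comm, ofConv_smul,
    LinearMap.smul_apply] at h1
  obtain ⟨k, -, hk⟩ := Finset.exists_ne_zero_of_sum_ne_zero (h1.trans_ne one_ne_zero)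
  obtain ⟨h2, h3⟩ := smul_ne_zero_iff.1 hk
  refine ⟨k, ((hX.coeff_eq_zero_or_one hα k).resolve_left h2).1, ?_⟩
  rcases hX.mul_eq_zero_or_exists i k with hz | ⟨l, hl⟩
  · simp [hz] at h3
  · rw [hl, hX.map_dual] at h3
    rw [hl, ← of_not_not fun hne => h3 (if_neg hne)]

/-- `χ * (χ ∘ S)` takes the value `1` at the dual element of the left unit of `χ`. -/
theorem conv_antipode_apply_dual (hX : IsCharSystem X d)
    (hα : (1 : WithConv (H →ₗ[K] K)) = ∑ i, α i • X i) {i k : ι} (hk : α k = 1)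
    (hki : X k * X i = X i) : (X i * toConv ((X i).ofConv ∘ₗ antipode K)) (d k) = 1 := by
  rw [conv_antipode_apply (l := X k) (hX.map_mul i), hki, hX.map_one]
  intro a
  rw [hα]
  simp [hX.map_mul, hX.map_dual, hk]

end Dual

end IsCharSystem

/-! ### One character: the radical vanishes -/

section Local

variable {K H : Type*} [Field K] [Ring H] [WeakHopfAlgebra K H]

/-- The slice `1₍₁₎ χ(1₍₂₎)` of `Δ(1)` by a multiplicative functional `χ` is idempotent. -/
theorem isIdempotentElem_slice_comul_one {X : WithConv (H →ₗ[K] K)}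
    (hX : ∀ a b, X (a * b) = X a * X b) :
    IsIdempotentElem
      (TensorProduct.rid K H (X.ofConv.lTensor H (Coalgebra.comul (R := K) (1 : H)))) := by
  have key : ∀ s t : H ⊗[K] H, TensorProduct.rid K H (X.ofConv.lTensor H (s * t)) =
      TensorProduct.rid K H (X.ofConv.lTensor H s) *
        TensorProduct.rid K H (X.ofConv.lTensor H t) := by
    intro s t
    induction s with
    | zero => simp
    | add s s' h h' => simp only [add_mul, map_add, h, h']
    | tmul x y =>
      induction t with
      | zero => simp
      | add s s' h h' => simp only [mul_add, map_add, h, h']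
      | tmul z w =>
        simp [hX]
        module
  rw [IsIdempotentElem, ← key, ← WeakBialgebra.comul_mul, mul_one]

theorem apply_slice_comul_one (X Y : WithConv (H →ₗ[K] K)) :
    Y (TensorProduct.rid K H (X.ofConv.lTensor H (Coalgebra.comul (R := K) (1 : H)))) =
      (Y * X) 1 := by
  rw [convMul_apply]
  generalize Coalgebra.comul (R := K) (1 : H) = s
  induction s with
  | zero => simp
  | add s s' h h' => simp only [map_add, h, h']
  | tmul x y => simp [mul_comm]

/-- If the square were zero, the slice of `Δ(1)` by `X` would be an idempotent killed by `X`, hence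
nilpotent, hence zero; yet `ε` takes the value `X 1 = 1` on it. -/
theorem not_conv_self_eq_zero_of_unique {X : WithConv (H →ₗ[K] K)} (hX1 : X 1 = 1)
    (hX : ∀ a b, X (a * b) = X a * X b) (hnil : ∀ z, X z = 0 → IsNilpotent z) : X * X ≠ 0 := by
  intro h0
  have hid := isIdempotentElem_slice_comul_one hX
  set v := TensorProduct.rid K H (X.ofConv.lTensor H (Coalgebra.comul (R := K) (1 : H))) with hv
  have h1 : X v = 0 := by rw [hv, apply_slice_comul_one, h0]; rfl
  have h2 : (1 : WithConv (H →ₗ[K] K)) v = 1 := by rw [hv, apply_slice_comul_one, one_mul, hX1]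
  obtain ⟨n, hn⟩ := hnil v h1
  have h3 : v = 0 := by rw [← hid.pow_succ_eq n, pow_succ, hn, zero_mul]
  rw [h3, map_zero] at h2
  exact zero_ne_one h2

/-- Descending induction shows that `ε` kills every positive power of `J`. If it kills the next
power, then for `x` in the current one both translates of `ε` by `x` equal `ε(x) • X`. Their
convolution is `ε(x * y * x) = 0`, and `X * X ≠ 0` forces `ε(x) = 0`. -/
theorem counit_eq_of_local {X : WithConv (H →ₗ[K] K)} (hX1 : X 1 = 1)
    (hX : ∀ a b, X (a * b) = X a * X b) {J : Ideal H} [J.IsTwoSided] (hJ : ∀ z, z ∈ J ↔ X z = 0)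
    (hnil : IsNilpotent J) (hXX : X * X ≠ 0) : (1 : WithConv (H →ₗ[K] K)) = X := by
  have hdec : ∀ y, y - X y • (1 : H) ∈ J := fun y => by simp [hJ, hX1]
  have hstep : ∀ k, (∀ x ∈ J ^ (k + 2), (1 : WithConv (H →ₗ[K] K)) x = 0) →
      ∀ x ∈ J ^ (k + 1), (1 : WithConv (H →ₗ[K] K)) x = 0 := by
    intro k hk x hx
    have hl : ∀ y, ((1 : WithConv (H →ₗ[K] K)) x • X) y = (1 : WithConv (H →ₗ[K] K)) (x * y) := by
      intro y
      have h := hk (x * (y - X y • 1)) (by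
        rw [Submodule.pow_succ]; exact Ideal.mul_mem_mul hx (hdec y))
      rw [mul_sub, map_sub, sub_eq_zero, mul_smul_comm, mul_one, map_smul, smul_eq_mul] at h
      rw [h]
      simp [mul_comm]
    have hm : ∀ y, ((1 : WithConv (H →ₗ[K] K)) x • X) y = (1 : WithConv (H →ₗ[K] K)) (y * x) := by
      intro y
      have h := hk ((y - X y • 1) * x) (by
        rw [Ideal.IsTwoSided.pow_succ]; exact Ideal.mul_mem_mul (hdec y) hx)
      rw [sub_mul, map_sub, sub_eq_zero, smul_mul_assoc, one_mul, map_smul, smul_eq_mul] at h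
      rw [h]
      simp [mul_comm]
    have hxJ : X x = 0 := (hJ x).1 (Ideal.pow_le_self (Nat.succ_ne_zero k) hx)
    by_contra hne
    apply hXX
    ext y
    have h := conv_counit_apply hl hm y
    rw [mul_assoc, ← hl, smul_mul_smul_comm] at h
    simp only [ofConv_smul, LinearMap.smul_apply, hX, hxJ, mul_zero, smul_eq_mul] at h
    exact (mul_eq_zero.1 h).resolve_left (mul_ne_zero hne hne)
  obtain ⟨N, hN⟩ := hnil
  have hall : ∀ m k, m + k = N + 2 → ∀ x ∈ J ^ (k + 1), (1 : WithConv (H →ₗ[K] K)) x = 0 := by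
    intro m
    induction m with
    | zero =>
      intro k hk x hx
      have : J ^ (k + 1) = 0 := by
        rw [show k + 1 = N + 3 by omega, Ideal.IsTwoSided.pow_add, hN, zero_mul]
      rw [this] at hx
      rw [(Submodule.mem_bot H).1 hx, map_zero]
    | succ m ih =>
      intro k hk
      exact hstep k (ih (k + 1) (by omega))
  have h1 : ∀ y, (1 : WithConv (H →ₗ[K] K)) y = (1 : WithConv (H →ₗ[K] K)) (1 : H) * X y := by
    intro y
    have h := hall (N + 2) 0 rfl (y - X y • 1) (by
      rw [zero_add, Submodule.pow_one]; exact hdec y)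
    rw [map_sub, sub_eq_zero, map_smul, smul_eq_mul, mul_comm] at h
    exact h
  set c := (1 : WithConv (H →ₗ[K] K)) (1 : H) with hc
  have h2 : (1 : WithConv (H →ₗ[K] K)) = c • X := WithConv.ext (LinearMap.ext h1)
  -- At this point `ε` is a multiple of `X`; the scalar is 1 because a one-element character system
  -- must contain a unit with coefficient 1.
  have hsys : IsCharSystem (fun _ : Fin 1 => X) (fun _ => (1 : H)) := by
    refine ⟨fun _ => hX, fun i j => ?_, fun z hz => ?_⟩
    · simp [hX1, Subsingleton.elim i j]
    · refine ⟨N, ?_⟩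
      have := Ideal.pow_mem_pow ((hJ z).2 (hz 0)) N
      rw [hN] at this
      exact (Submodule.mem_bot H).1 this
  have hα : (1 : WithConv (H →ₗ[K] K)) = ∑ i : Fin 1, (fun _ => c) i • (fun _ : Fin 1 => X) i := by
    simpa using h2
  obtain ⟨k, hk, -⟩ := hsys.exists_left_unit hα 0
  rw [h2, show c = 1 from hk, one_smul]

/-- A finite-dimensional weak Hopf algebra in characteristic zero which is local with residue field
`K` is one-dimensional. -/
theorem eq_bot_of_local [CharZero K] {X : WithConv (H →ₗ[K] K)} (hX1 : X 1 = 1)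
    (hX : ∀ a b, X (a * b) = X a * X b) {J : Ideal H} [J.IsTwoSided] (hJ : ∀ z, z ∈ J ↔ X z = 0)
    (hnil : IsNilpotent J) : J = ⊥ := by
  by_contra hbot
  have hmemnil : ∀ z, X z = 0 → IsNilpotent z := by
    intro z hz
    obtain ⟨N, hN⟩ := hnil
    refine ⟨N, ?_⟩
    have := Ideal.pow_mem_pow ((hJ z).2 hz) N
    rw [hN] at this
    exact (Submodule.mem_bot H).1 this
  have hε := counit_eq_of_local hX1 hX hJ hnil (not_conv_self_eq_zero_of_unique hX1 hX hmemnil)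
  have hsq : ¬ J ≤ J * J := by
    intro hle
    have hidem : ∀ n, J ≤ J ^ (n + 1) := by
      intro n
      induction n with
      | zero => rw [zero_add, Submodule.pow_one]
      | succ n ih => rw [Submodule.pow_succ]; exact hle.trans (Ideal.mul_mono_left ih)
    obtain ⟨N, hN⟩ := hnil
    have h := hidem N
    rw [Submodule.pow_succ, hN, zero_mul] at h
    exact hbot (le_bot_iff.1 h)
  obtain ⟨x, hxJ, hxJJ⟩ := SetLike.not_le_iff_exists.1 hsq
  have hx0 := (hJ x).1 hxJ
  -- A functional killing `J * J` and `1` satisfies the Leibniz rule relative to `X = ε`, because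
  -- `(a - X a • 1) * (b - X b • 1)` lies in `J * J`.
  let W : Submodule K H := (J * J).restrictScalars K ⊔ K ∙ (1 : H)
  have hxW : x ∉ W := by
    intro h
    obtain ⟨j, hj, w, hw, hjw⟩ := Submodule.mem_sup.1 h
    obtain ⟨c, rfl⟩ := Submodule.mem_span_singleton.1 hw
    have hjJ : X j = 0 := (hJ j).1 (Ideal.mul_le_right hj)
    have hc : c = 0 := by
      have := congrArg X.ofConv hjw
      simpa [hjJ, hX1, hx0] using this
    rw [hc, zero_smul, add_zero] at hjw
    exact hxJJ (hjw ▸ hj)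
  obtain ⟨f₀, hf₀, hfW⟩ := Submodule.exists_le_ker_of_notMem hxW
  let f : WithConv (H →ₗ[K] K) := toConv ((f₀ x)⁻¹ • f₀)
  have hfx : f x = 1 := by simp [f, hf₀]
  have hfW' : ∀ w ∈ W, f w = 0 := fun w hw => by
    have : f₀ w = 0 := hfW hw
    simp [f, this]
  have hf1 : f 1 = 0 := hfW' _ (Submodule.mem_sup_right (Submodule.mem_span_singleton_self _))
  have hder : ∀ a b, f (a * b) = (1 : WithConv (H →ₗ[K] K)) a * f b +
      f a * (1 : WithConv (H →ₗ[K] K)) b := by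
    intro a b
    rw [hε]
    have h := hfW' ((a - X a • 1) * (b - X b • 1)) (Submodule.mem_sup_left
      (show _ ∈ J * J from Ideal.mul_mem_mul ((hJ _).2 (by simp [hX1]))
        ((hJ _).2 (by simp [hX1]))))
    simp only [mul_sub, sub_mul, mul_smul_comm, smul_mul_assoc, mul_one, one_mul, map_sub,
      map_smul, hf1, smul_eq_mul] at h
    linear_combination h
  have hD := leftContract_mul hder
  set D := leftContract f
  have hDpow : ∀ n, ∀ z ∈ J ^ (n + 1), D z ∈ J ^ n := by
    intro n
    induction n with
    | zero => simp [Submodule.pow_zero]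
    | succ n ih =>
      intro z hz
      rw [Submodule.pow_succ] at hz
      refine Submodule.smul_induction_on hz (fun a ha b hb => ?_) (fun a b ha hb => ?_)
      · rw [smul_eq_mul, hD]
        refine add_mem (Ideal.mul_mem_right _ _ ha) ?_
        rw [Submodule.pow_succ]
        exact Ideal.mul_mem_mul (ih a ha) hb
      · rw [map_add]
        exact add_mem ha hb
  have hxpow : ∀ n, x ^ n ∈ J ^ n := Ideal.pow_mem_pow hxJ
  -- To leading order `D` acts as `d/dx`, since `D x` is `1` modulo `J`.
  have hDx : ∀ n : ℕ, D (x ^ (n + 1)) - ((n : K) + 1) • x ^ n ∈ J ^ (n + 1) := by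
    have h0 : D x - 1 ∈ J := by
      rw [hJ, map_sub, hX1, ← hε, counit_leftContract, hfx, sub_self]
    intro n
    induction n with
    | zero => simpa [Submodule.pow_one] using h0
    | succ n ih =>
      have e : D (x ^ (n + 1 + 1)) - (((n + 1 : ℕ) : K) + 1) • x ^ (n + 1) =
          x ^ (n + 1) * (D x - 1) + (D (x ^ (n + 1)) - ((n : K) + 1) • x ^ n) * x := by
        rw [pow_succ x (n + 1), hD, mul_sub, mul_one, sub_mul, smul_mul_assoc, ← pow_succ]
        push_cast
        module
      rw [e, Submodule.pow_succ]
      exact add_mem (Ideal.mul_mem_mul (hxpow _) h0) (Ideal.mul_mem_mul ih hxJ)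
  -- If `x ^ (n + 1)` lay one power deeper, applying `D` and dividing by `n + 1` would put `x ^ n`
  -- one power deeper too. This is where characteristic zero enters; nilpotency of `J` then gives
  -- the contradiction.
  have hnot : ∀ n, x ^ n ∉ J ^ (n + 1) := by
    intro n
    induction n with
    | zero => simp [Submodule.pow_one, hJ, hX1]
    | succ n ih =>
      intro h
      apply ih
      have h1 := sub_mem (hDpow _ _ h) (hDx n)
      rw [sub_sub_cancel] at h1
      have h2 : ((n : K) + 1) ≠ 0 := Nat.cast_add_one_ne_zero n
      have h3 := Submodule.smul_mem ((J ^ (n + 1)).restrictScalars K) ((n : K) + 1)⁻¹ h1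
      rwa [inv_smul_smul₀ h2] at h3
  obtain ⟨N, hN⟩ := hnil
  apply hnot N
  have := hxpow N
  rw [hN] at this
  rw [(Submodule.mem_bot H).1 this]
  exact zero_mem _

end Local

/-! ### Two characters: exclusion of a one-dimensional radical -/

/-- The data describing an algebra with a two-element character system whose radical is spanned by
a single vector `x`, on which the algebra acts through the characters `X s` and `X t`. -/
structure IsTwoCharSystem {K H : Type*} [Field K] [Ring H] [Algebra K H]
    (X : Fin 2 → WithConv (H →ₗ[K] K)) (d : Fin 2 → H) (x : H) (f : WithConv (H →ₗ[K] K))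
    (s t : Fin 2) : Prop extends IsCharSystem X d where
  apply_rad : ∀ i, X i x = 0
  coord_rad : f x = 1
  coord_dual : ∀ i, f (d i) = 0
  eq_sum : ∀ g : WithConv (H →ₗ[K] K), g = g (d 0) • X 0 + g (d 1) • X 1 + g x • f
  mul_rad : ∀ y, y * x = X s y • x
  rad_mul : ∀ y, x * y = X t y • x
  coord_mul : ∀ a b, f (a * b) = X s a * f b + f a * X t b

namespace IsTwoCharSystem

variable {K H : Type*} [Field K] [Ring H] [WeakHopfAlgebra K H]
  {X : Fin 2 → WithConv (H →ₗ[K] K)} {d : Fin 2 → H} {x : H} {f : WithConv (H →ₗ[K] K)}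
  {s t : Fin 2}

theorem conv_apply_rad (h : IsTwoCharSystem X d x f s t) (i j : Fin 2) : (X i * X j) x = 0 := by
  rcases h.mul_eq_zero_or_exists i j with h0 | ⟨k, hk⟩
  · rw [h0]; rfl
  · rw [hk, h.apply_rad]

/-- The coordinate `f` is skew-primitive with ends `X s` and `X t`; convolving with a character
moves both ends. -/
theorem char_conv_coord_mul (h : IsTwoCharSystem X d x f s t) (i : Fin 2) (a b : H) :
    (X i * f) (a * b) = (X i * X s) a * (X i * f) b + (X i * f) a * (X i * X t) b := by
  have := conv_mul_apply (l := X i) (m := f) (l₁ := X i) (l₁' := X i) (l₂ := 0) (l₂' := 0)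
    (m₁ := X s) (m₁' := f) (m₂ := f) (m₂' := X t) (by simp [h.map_mul]) h.coord_mul a b
  simpa using this

theorem coord_conv_char_mul (h : IsTwoCharSystem X d x f s t) (i : Fin 2) (a b : H) :
    (f * X i) (a * b) = (X s * X i) a * (f * X i) b + (f * X i) a * (X t * X i) b := by
  have := conv_mul_apply (l := f) (m := X i) (m₁ := X i) (m₁' := X i) (m₂ := 0) (m₂' := 0)
    (l₁ := X s) (l₁' := f) (l₂ := f) (l₂' := X t) h.coord_mul (by simp [h.map_mul]) a b
  simpa using this

/-- Here and in the next three lemmas, `x` is split as `1 * x` or `x * 1`. One term dies by the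
hypothesis, the other because products of characters kill `x`. -/
theorem char_conv_coord_apply_rad_of_left (h : IsTwoCharSystem X d x f s t) {i : Fin 2}
    (hi : X i * X s = 0) : (X i * f) x = 0 := by
  have := h.char_conv_coord_mul i 1 x
  rwa [hi, h.conv_apply_rad, mul_zero, one_mul, ofConv_zero, LinearMap.zero_apply, zero_mul,
    add_zero] at this

theorem char_conv_coord_apply_rad_of_right (h : IsTwoCharSystem X d x f s t) {i : Fin 2}
    (hi : X i * X t = 0) : (X i * f) x = 0 := by
  have := h.char_conv_coord_mul i x 1
  rwa [hi, h.conv_apply_rad, zero_mul, mul_one, ofConv_zero, LinearMap.zero_apply, mul_zero,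
    add_zero] at this

theorem coord_conv_char_apply_rad_of_left (h : IsTwoCharSystem X d x f s t) {i : Fin 2}
    (hi : X s * X i = 0) : (f * X i) x = 0 := by
  have := h.coord_conv_char_mul i 1 x
  rwa [hi, h.conv_apply_rad, mul_zero, one_mul, ofConv_zero, LinearMap.zero_apply, zero_mul,
    add_zero] at this

theorem coord_conv_char_apply_rad_of_right (h : IsTwoCharSystem X d x f s t) {i : Fin 2}
    (hi : X t * X i = 0) : (f * X i) x = 0 := by
  have := h.coord_conv_char_mul i x 1
  rwa [hi, h.conv_apply_rad, zero_mul, mul_one, ofConv_zero, LinearMap.zero_apply, mul_zero,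
    add_zero] at this

theorem rad_mul_rad (h : IsTwoCharSystem X d x f s t) : x * x = 0 := by
  rw [h.mul_rad, h.apply_rad, zero_smul]

theorem counit_mul_rad (h : IsTwoCharSystem X d x f s t) (y : H) :
    ((1 : WithConv (H →ₗ[K] K)) x • X s) y = (1 : WithConv (H →ₗ[K] K)) (y * x) := by
  rw [h.mul_rad, map_smul, smul_eq_mul, mul_comm]; rfl

theorem counit_rad_mul (h : IsTwoCharSystem X d x f s t) (y : H) :
    ((1 : WithConv (H →ₗ[K] K)) x • X t) y = (1 : WithConv (H →ₗ[K] K)) (x * y) := by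
  rw [h.rad_mul, map_smul, smul_eq_mul, mul_comm]; rfl

theorem counit_apply (h : IsTwoCharSystem X d x f s t) (y : H) :
    (1 : WithConv (H →ₗ[K] K)) y = (1 : WithConv (H →ₗ[K] K)) (d 0) * X 0 y +
      (1 : WithConv (H →ₗ[K] K)) (d 1) * X 1 y + (1 : WithConv (H →ₗ[K] K)) x * f y := by
  have := congrArg (fun g : WithConv (H →ₗ[K] K) => g y) (h.eq_sum 1)
  exact this

/-- The two translates of `ε` by `x` are `ε(x) • X t` and `ε(x) • X s`. Their product is `y ↦ ε(x *
y * x)`, and `x * y * x` is a multiple of `x * x = 0`. -/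
theorem conv_eq_zero_of_counit_rad_ne_zero (h : IsTwoCharSystem X d x f s t)
    (hγ : (1 : WithConv (H →ₗ[K] K)) x ≠ 0) : X t * X s = 0 := by
  ext y
  have := conv_counit_apply h.counit_rad_mul h.counit_mul_rad y
  rw [h.rad_mul, smul_mul_assoc (X t y) x x, h.rad_mul_rad, smul_zero, map_zero, smul_mul_smul_comm,
    ofConv_smul, LinearMap.smul_apply, smul_eq_mul] at this
  exact (mul_eq_zero.1 this).resolve_left (mul_ne_zero hγ hγ)

/-- As `X t * X s = 0`, also `X t * f` is a multiple of `X t * X t`. Weak multiplicativity at `x * y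
* d t` then exhibits `X t` as a multiple of `X t * X t`, which is zero or a character. -/
theorem conv_right_self_of_counit_rad_ne_zero (h : IsTwoCharSystem X d x f s t)
    (hγ : (1 : WithConv (H →ₗ[K] K)) x ≠ 0) : X t * X t = X t := by
  have h0 := h.conv_eq_zero_of_counit_rad_ne_zero hγ
  set γ := (1 : WithConv (H →ₗ[K] K)) x with hγdef
  have hf : X t * f = (X t * f) 1 • (X t * X t) := by
    ext y
    have := h.char_conv_coord_mul t 1 y
    rw [h0, one_mul, ofConv_zero, LinearMap.zero_apply, zero_mul, zero_add] at this
    rw [this]; rfl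
  have hm : ∀ y, ((1 : WithConv (H →ₗ[K] K)) (d t) • X t + γ • f) y =
      (1 : WithConv (H →ₗ[K] K)) (y * d t) := by
    intro y
    rw [h.counit_apply (y * d t), h.map_mul, h.map_mul, h.map_dual, h.map_dual, h.coord_mul, h.coord_dual,
      h.map_dual, if_pos rfl]
    fin_cases t <;> simp [hγdef]
  have key : (γ • X t) * ((1 : WithConv (H →ₗ[K] K)) (d t) • X t + γ • f) = γ • X t := by
    ext y
    rw [conv_counit_apply h.counit_rad_mul hm, mul_assoc, h.rad_mul, h.map_mul, h.map_dual,
      if_pos rfl, mul_one, map_smul, smul_eq_mul, mul_comm]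
    rfl
  rw [smul_mul_assoc] at key
  replace key := smul_right_injective _ hγ key
  simp only [mul_add, mul_smul_comm] at key
  rw [hf] at key
  rcases h.mul_eq_zero_or_exists t t with hz | ⟨k, hk⟩
  · rw [hz] at key
    simp only [smul_zero, add_zero] at key
    exact absurd key.symm (h.ne_zero t)
  · rw [hk] at key ⊢
    by_contra hne
    have hkt : k ≠ t := fun e => hne (by rw [e])
    have := congrArg (fun g : WithConv (H →ₗ[K] K) => g (d t)) key
    simp [h.map_dual, hkt] at this

theorem conv_left_self_of_counit_rad_ne_zero (h : IsTwoCharSystem X d x f s t)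
    (hγ : (1 : WithConv (H →ₗ[K] K)) x ≠ 0) : X s * X s = X s := by
  have h0 := h.conv_eq_zero_of_counit_rad_ne_zero hγ
  set γ := (1 : WithConv (H →ₗ[K] K)) x with hγdef
  have hf : f * X s = (f * X s) 1 • (X s * X s) := by
    ext y
    have := h.coord_conv_char_mul s y 1
    rw [h0, mul_one, ofConv_zero, LinearMap.zero_apply, mul_zero, add_zero, mul_comm] at this
    rw [this]; rfl
  have hl : ∀ y, ((1 : WithConv (H →ₗ[K] K)) (d s) • X s + γ • f) y =
      (1 : WithConv (H →ₗ[K] K)) (d s * y) := by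
    intro y
    rw [h.counit_apply (d s * y), h.map_mul, h.map_mul, h.map_dual, h.map_dual, h.coord_mul, h.coord_dual,
      h.map_dual, if_pos rfl]
    fin_cases s <;> simp [hγdef]
  have key : ((1 : WithConv (H →ₗ[K] K)) (d s) • X s + γ • f) * (γ • X s) = γ • X s := by
    ext y
    rw [conv_counit_apply hl h.counit_mul_rad, h.mul_rad, h.map_mul, h.map_dual,
      if_pos rfl, one_mul, map_smul, smul_eq_mul, mul_comm]
    rfl
  rw [mul_smul_comm] at key
  replace key := smul_right_injective _ hγ key
  simp only [add_mul, smul_mul_assoc] at key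
  rw [hf] at key
  rcases h.mul_eq_zero_or_exists s s with hz | ⟨k, hk⟩
  · rw [hz] at key
    simp only [smul_zero, add_zero] at key
    exact absurd key.symm (h.ne_zero s)
  · rw [hk] at key ⊢
    by_contra hne
    have hks : k ≠ s := fun e => hne (by rw [e])
    have := congrArg (fun g : WithConv (H →ₗ[K] K) => g (d s)) key
    simp [h.map_dual, hks] at this

/-- Otherwise `X s` and `X t` are distinct orthogonal idempotents. The antipode axiom gives `X s *
(X s ∘ S)` the value `ε(x)` at `x`, but anything of the form `X s * g` vanishes there. -/
theorem counit_rad (h : IsTwoCharSystem X d x f s t) : (1 : WithConv (H →ₗ[K] K)) x = 0 := by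
  by_contra hγ
  have hts := h.conv_eq_zero_of_counit_rad_ne_zero hγ
  have htt := h.conv_right_self_of_counit_rad_ne_zero hγ
  have hss := h.conv_left_self_of_counit_rad_ne_zero hγ
  have hne : s ≠ t := by
    rintro rfl
    exact h.ne_zero s (hss.symm.trans hts)
  have hst : X s * X t = 0 := by
    rcases h.mul_eq_zero_or_exists s t with hz | ⟨k, hk⟩
    · exact hz
    · rcases (show k = s ∨ k = t by omega) with rfl | rfl
      · have : X k * X t * X k = X k := by rw [hk, hss]
        rw [mul_assoc, hts, mul_zero] at this
        exact absurd this.symm (h.ne_zero k)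
      · have : X k * (X s * X k) = X k := by rw [hk, htt]
        rw [← mul_assoc, hts, zero_mul] at this
        exact absurd this.symm (h.ne_zero k)
  have h1 := conv_antipode_apply (h.map_mul s) h.counit_mul_rad
  rw [smul_mul_assoc, hss, ofConv_smul, LinearMap.smul_apply, h.map_one, smul_eq_mul, mul_one,
    h.eq_sum (toConv ((X s).ofConv ∘ₗ antipode K))] at h1
  simp only [mul_add, mul_smul_comm, ofConv_add, ofConv_smul, LinearMap.add_apply,
    LinearMap.smul_apply, h.conv_apply_rad, h.char_conv_coord_apply_rad_of_right hst, smul_zero,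
    add_zero] at h1
  exact hγ h1.symm

theorem counit_eq (h : IsTwoCharSystem X d x f s t) :
    (1 : WithConv (H →ₗ[K] K)) = ∑ i, (1 : WithConv (H →ₗ[K] K)) (d i) • X i := by
  rw [Fin.sum_univ_two]
  conv_lhs => rw [h.eq_sum 1, h.counit_rad, zero_smul, add_zero]

/-- Exclusion of the case in which both characters are identities. -/
theorem not_conv_orthogonal [CharZero K] (h : IsTwoCharSystem X d x f s t)
    (horth : ∀ i j, X i * X j = if i = j then X i else 0)
    (h1 : (1 : WithConv (H →ₗ[K] K)) = ∑ i, X i) : False := by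
  have hl : f = f * X 0 + f * X 1 := by
    conv_lhs => rw [← mul_one f, h1, Fin.sum_univ_two, mul_add]
  have hr : f = X 0 * f + X 1 * f := by
    conv_lhs => rw [← one_mul f, h1, Fin.sum_univ_two, add_mul]
  have hlx := congrArg (fun g : WithConv (H →ₗ[K] K) => g x) hl
  have hrx := congrArg (fun g : WithConv (H →ₗ[K] K) => g x) hr
  simp only [h.coord_rad, ofConv_add, LinearMap.add_apply] at hlx hrx
  by_cases hst : s = t
  · subst hst
    have hne : ∀ i, i ≠ s → (f * X i) x = 0 ∧ (X i * f) x = 0 := fun i hi =>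
      ⟨h.coord_conv_char_apply_rad_of_left (by rw [horth, if_neg hi.symm]),
        h.char_conv_coord_apply_rad_of_left (by rw [horth, if_neg hi])⟩
    have hfs : (f * X s) x = 1 ∧ (X s * f) x = 1 := by
      rcases (show s = 0 ∨ s = 1 by omega) with rfl | rfl
      · obtain ⟨h2, h3⟩ := hne 1 (by decide)
        rw [h2, add_zero] at hlx
        rw [h3, add_zero] at hrx
        exact ⟨hlx.symm, hrx.symm⟩
      · obtain ⟨h2, h3⟩ := hne 0 (by decide)
        rw [h2, zero_add] at hlx
        rw [h3, zero_add] at hrx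
        exact ⟨hlx.symm, hrx.symm⟩
    -- Evaluating `f * f` at `x * x = 0`, the two mixed terms contribute 1 each and the outer terms
    -- vanish, so `2 = 0`.
    have := conv_mul_apply h.coord_mul h.coord_mul x x
    rw [h.rad_mul_rad, map_zero, h.conv_apply_rad, hfs.1, hfs.2] at this
    norm_num at this
  · have h0 : ∀ i, (f * X i) x = 0 := by
      intro i
      by_cases hi : s = i
      · exact h.coord_conv_char_apply_rad_of_right (by
          rw [horth, if_neg (fun e => hst (hi.trans e.symm))])
      · exact h.coord_conv_char_apply_rad_of_left (by rw [horth, if_neg hi])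
    rw [h0, h0, add_zero] at hlx
    exact one_ne_zero hlx

/-- Exclusion of the case in which exactly one character is an identity. -/
theorem not_counit_eq_char (h : IsTwoCharSystem X d x f s t) {i j : Fin 2} (hij : i ≠ j)
    (h1 : (1 : WithConv (H →ₗ[K] K)) = X i) : False := by
  have hX1 : ∀ k, X i * X k = X k ∧ X k * X i = X k := fun k => by
    rw [← h1]; exact ⟨one_mul _, mul_one _⟩
  -- With a single identity, the antipode makes `X j` invertible; the two characters then form a
  -- group of order 2.
  have hinv : X j * toConv ((X j).ofConv ∘ₗ antipode K) = 1 := by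
    ext y
    rw [conv_antipode_apply (l := X i y • X i) (h.map_mul j), smul_mul_assoc, (hX1 j).1,
      ofConv_smul, LinearMap.smul_apply, h.map_one, smul_eq_mul, mul_one, h1]
    intro a
    rw [h1, h.map_mul, mul_comm]
    rfl
  have hjj : X j * X j = X i := by
    rcases h.mul_eq_zero_or_exists j j with hz | ⟨k, hk⟩
    · have : X j = 0 := by rw [← mul_one (X j), ← hinv, ← mul_assoc, hz, zero_mul]
      exact absurd this (h.ne_zero j)
    · rcases (show k = i ∨ k = j by omega) with rfl | rfl
      · exact hk
      · have : X k = X i := by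
          rw [← mul_one (X k), ← hinv, ← mul_assoc, hk, hinv, h1]
        exact absurd (h.injective this).symm hij
  have hne : ∀ k, X j * X k ≠ X k := by
    intro k e
    rcases (show k = i ∨ k = j by omega) with rfl | rfl
    · rw [(hX1 j).2] at e
      exact hij (h.injective e).symm
    · rw [hjj] at e
      exact hij (h.injective e)
  -- If not, comparing both expressions for `X j * f` at `y * x` would give `X j * X s = X s`, but
  -- `X j` acts without fixed points.
  have hg : (X j * f) x = 0 := by
    by_contra hgx
    apply hne s
    ext y
    have := h.char_conv_coord_mul j y x
    rw [h.mul_rad, map_smul, h.conv_apply_rad, mul_zero, add_zero, smul_eq_mul] at this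
    exact (mul_right_cancel₀ hgx this).symm
  -- `X j * f` is now a combination of characters, hence so is `f`, contradicting `f x = 1`.
  have hf : f = X j * (X j * f) := by rw [← mul_assoc, hjj, ← h1, one_mul]
  have hfx := congrArg (fun g : WithConv (H →ₗ[K] K) => g x) hf
  rw [h.eq_sum (X j * f), hg] at hfx
  simp only [mul_add, mul_smul_comm, ofConv_add, ofConv_smul, LinearMap.add_apply,
    LinearMap.smul_apply, h.conv_apply_rad, h.coord_rad, zero_smul, smul_zero, add_zero] at hfx
  exact one_ne_zero hfx

end IsTwoCharSystem

/-- There is no three-dimensional weak Hopf algebra in characteristic zero with exactly two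
characters and a one-dimensional radical. -/
theorem not_isTwoCharSystem {K H : Type*} [Field K] [CharZero K] [Ring H] [WeakHopfAlgebra K H]
    {X : Fin 2 → WithConv (H →ₗ[K] K)} {d : Fin 2 → H} {x : H} {f : WithConv (H →ₗ[K] K)}
    {s t : Fin 2} : ¬ IsTwoCharSystem X d x f s t := by
  intro h
  have hα := h.counit_eq
  have hsum : ∀ i j : Fin 2, i ≠ j → (1 : WithConv (H →ₗ[K] K)) =
      (1 : WithConv (H →ₗ[K] K)) (d i) • X i + (1 : WithConv (H →ₗ[K] K)) (d j) • X j := by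
    intro i j hij
    rw [Fin.sum_univ_two] at hα
    rcases (show i = 0 ∧ j = 1 ∨ i = 1 ∧ j = 0 by omega) with ⟨rfl, rfl⟩ | ⟨rfl, rfl⟩
    · exact hα
    · exact hα.trans (add_comm _ _)
  have hone := h.toIsCharSystem.coeff_eq_zero_or_one hα
  have hmix : ∀ i j : Fin 2, i ≠ j → (1 : WithConv (H →ₗ[K] K)) (d i) = 1 →
      (1 : WithConv (H →ₗ[K] K)) (d j) = 0 → False := by
    intro i j hij h1 h0
    have := hsum i j hij
    rw [h1, h0, one_smul, zero_smul, add_zero] at this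
    exact h.not_counit_eq_char hij this
  rcases hone 0 with h0 | ⟨h0, h00⟩ <;> rcases hone 1 with h1 | ⟨h1, h11⟩
  · obtain ⟨k, hk, -⟩ := h.toIsCharSystem.exists_left_unit hα 0
    rcases (show k = 0 ∨ k = 1 by omega) with rfl | rfl
    · exact zero_ne_one (h0.symm.trans hk)
    · exact zero_ne_one (h1.symm.trans hk)
  · exact hmix 1 0 (by decide) h1 h0
  · exact hmix 0 1 (by decide) h0 h1
  · have hall : ∀ i, (1 : WithConv (H →ₗ[K] K)) (d i) = 1 := by
      intro i
      rcases (show i = 0 ∨ i = 1 by omega) with rfl | rfl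
      exacts [h0, h1]
    refine h.not_conv_orthogonal (fun i j => ?_) (by simpa only [hall, one_smul] using hα)
    by_cases hij : i = j
    · subst hij
      rw [if_pos rfl]
      rcases (show i = 0 ∨ i = 1 by omega) with rfl | rfl
      exacts [h00, h11]
    · rw [if_neg hij]
      exact h.toIsCharSystem.mul_eq_zero_of_ne hα hij (by simp [hall]) (by simp [hall])

/-! ### Reduction to the split semisimple case -/

/-- An algebra of dimension at most three over an algebraically closed field is basic: modulo a
nilpotent ideal it is a power of the field. -/
theorem exists_algHom_pi_of_finrank_le_three {K H : Type*} [Field K] [IsAlgClosed K] [Ring H]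
    [Algebra K H] [FiniteDimensional K H] (hdim : Module.finrank K H ≤ 3) :
    ∃ (n : ℕ) (π : H →ₐ[K] (Fin n → K)), Function.Surjective π ∧
      IsNilpotent (RingHom.ker π : Ideal H) := by
  have : IsArtinianRing H := IsArtinianRing.of_finite K H
  have : IsSemisimpleRing (H ⧸ Ring.jacobson H) := IsSemiprimaryRing.isSemisimpleRing
  let mk : H →ₐ[K] H ⧸ Ring.jacobson H := Ideal.Quotient.mkₐ K (Ring.jacobson H)
  have hmk : Function.Surjective mk := Ideal.Quotient.mkₐ_surjective K _
  obtain ⟨n, d, hd, ⟨e⟩⟩ :=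
    IsSemisimpleRing.exists_algEquiv_pi_matrix_of_isAlgClosed K (H ⧸ Ring.jacobson H)
  have hfin : ∑ i, d i * d i ≤ 3 := by
    have h1 : Module.finrank K (H ⧸ Ring.jacobson H) = ∑ i, d i * d i := by
      rw [e.toLinearEquiv.finrank_eq, Module.finrank_pi_fintype]
      simp [Module.finrank_matrix]
    rw [← h1]
    exact (LinearMap.finrank_le_finrank_of_surjective (f := mk.toLinearMap) hmk).trans hdim
  obtain rfl : d = fun _ => 1 := by
    funext i
    have h1 : d i * d i ≤ 3 :=
      (Finset.single_le_sum (f := fun i => d i * d i) (fun _ _ => Nat.zero_le _)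
        (Finset.mem_univ i)).trans hfin
    have h2 := (hd i).out
    have h3 : d i < 2 := by
      by_contra hlt
      push Not at hlt
      have := Nat.mul_le_mul hlt hlt
      omega
    omega
  let u : Matrix (Fin 1) (Fin 1) K ≃ₐ[K] K :=
    { toFun := fun M => M 0 0
      invFun := fun c => Matrix.of fun _ _ => c
      left_inv := fun M => by ext i j; simp [Subsingleton.elim i 0, Subsingleton.elim j 0]
      right_inv := fun c => rfl
      map_mul' := fun M N => by simp [Matrix.mul_apply]
      map_add' := fun M N => rfl
      commutes' := fun c => by simp [Matrix.algebraMap_matrix_apply] }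
  let e' : (H ⧸ Ring.jacobson H) ≃ₐ[K] (Fin n → K) :=
    e.trans (AlgEquiv.piCongrRight fun _ => u)
  refine ⟨n, e'.toAlgHom.comp mk, e'.surjective.comp hmk, ?_⟩
  have hker : (RingHom.ker (e'.toAlgHom.comp mk) : Ideal H) = Ring.jacobson H := by
    ext z
    rw [RingHom.mem_ker]
    simp [mk, Ideal.Quotient.eq_zero_iff_mem]
  rw [hker]
  exact IsSemiprimaryRing.isNilpotent

/-- The two-character data of a basic algebra whose radical is a line. -/
theorem exists_isTwoCharSystem {K H : Type*} [Field K] [Ring H] [Algebra K H]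
    {π : H →ₐ[K] (Fin 2 → K)} (hπ : Function.Surjective π) {x : H} (hx0 : x ≠ 0)
    (hxπ : π x = 0) (hx : ∀ z, π z = 0 → ∃ c : K, c • x = z) (hxn : IsNilpotent x) :
    ∃ (X : Fin 2 → WithConv (H →ₗ[K] K)) (d : Fin 2 → H) (f : WithConv (H →ₗ[K] K))
      (s t : Fin 2), IsTwoCharSystem X d x f s t := by
  let X : Fin 2 → WithConv (H →ₗ[K] K) := fun i => toConv (LinearMap.proj i ∘ₗ π.toLinearMap)
  have hXπ : ∀ i y, X i y = π y i := fun i y => rfl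
  obtain ⟨φ, hφ⟩ := Module.Projective.exists_dual_eq_one K hx0
  have hφJ : ∀ z, π z = 0 → φ z • x = z := by
    intro z hz
    obtain ⟨c, rfl⟩ := hx z hz
    rw [map_smul, hφ, smul_eq_mul, mul_one]
  have hL : ∀ y, φ (y * x) • x = y * x := fun y => hφJ _ (by rw [map_mul, hxπ, mul_zero])
  have hR : ∀ y, φ (x * y) • x = x * y := fun y => hφJ _ (by rw [map_mul, hxπ, zero_mul])
  have hxx : x * x = 0 := by
    obtain ⟨n, hn⟩ := hxn
    -- `x * x` is a scalar multiple of `x`, and nilpotency makes the scalar zero.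
    have hpow : ∀ k, x ^ (k + 1) = φ (x * x) ^ k • x := by
      intro k
      induction k with
      | zero => simp
      | succ k ih => rw [pow_succ, ih, smul_mul_assoc, ← hL x, smul_smul, pow_succ, hL x]
    have h0 : φ (x * x) ^ n • x = 0 := by rw [← hpow, pow_succ, hn, zero_mul]
    have h1 : φ (x * x) = 0 :=
      IsNilpotent.eq_zero ⟨n, (smul_eq_zero.1 h0).resolve_right hx0⟩
    rw [← hL x, h1, zero_smul]
  obtain ⟨a, ha⟩ := hπ (Pi.single 0 1)
  have hJJ : ∀ z w, π z = 0 → π w = 0 → z * w = 0 := by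
    intro z w hz hw
    rw [← hφJ z hz, ← hφJ w hw, smul_mul_smul_comm, hxx, smul_zero]
  -- The polynomial `3a² - 2a³` lifts an idempotent modulo a square-zero ideal: `p² - p` is
  -- divisible by `(a² - a)²`.
  let p : H := 3 * (a * a) - 2 * (a * a * a)
  have hpp : p * p = p := by
    have h1 : (a * a - a) * (a * a - a) = 0 := by
      have : π (a * a - a) = 0 := by
        rw [map_sub, map_mul, ha]
        ext i
        fin_cases i <;> simp
      exact hJJ _ _ this this
    have h2 : p * p - p = (a * a - a) * (a * a - a) * (4 * (a * a) - 4 * a - 3) := by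
      simp only [p]
      noncomm_ring
    rw [h1, zero_mul, sub_eq_zero] at h2
    exact h2
  have hp : π p = Pi.single 0 1 := by
    simp only [p, map_sub, map_mul, ha, map_ofNat]
    ext i
    fin_cases i <;> simp
    norm_num
  let d : Fin 2 → H := ![p, 1 - p]
  have hd : ∀ i j, X i (d j) = if i = j then 1 else 0 := by
    intro i j
    rw [hXπ]
    fin_cases i <;> fin_cases j <;> simp [d, hp]
  have hmul : ∀ i a b, X i (a * b) = X i a * X i b := fun i a b => by simp [hXπ]
  have hX : IsCharSystem X d := by
    refine ⟨hmul, hd, fun z hz => ⟨2, ?_⟩⟩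
    rw [pow_two]
    exact hJJ _ _ (funext hz) (funext hz)
  have hchar : ∀ g : WithConv (H →ₗ[K] K), (∀ a b, g (a * b) = g a * g b) → g 1 = 1 →
      ∃ i, ∀ y, g y = X i y := by
    intro g hg hg1
    rcases hX.eq_zero_or_exists hg with h0 | ⟨i, hi⟩
    · rw [h0] at hg1
      exact absurd hg1 zero_ne_one
    · exact ⟨i, fun y => by rw [hi]⟩
  -- The radical is a line, so `H` acts on it from each side through a character; these are `X s`
  -- and `X t`.
  obtain ⟨s, hs⟩ := hchar (toConv (φ ∘ₗ LinearMap.mulRight K x)) (fun a b => by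
    simp only [coe_comp, Function.comp_apply, mulRight_apply]
    rw [mul_assoc, ← hL b, mul_smul_comm, map_smul, hL b, smul_eq_mul, mul_comm]) (by simp [hφ])
  obtain ⟨t, ht⟩ := hchar (toConv (φ ∘ₗ LinearMap.mulLeft K x)) (fun a b => by
    simp only [coe_comp, Function.comp_apply, mulLeft_apply]
    rw [← mul_assoc, ← hR a, smul_mul_assoc, map_smul, hR a, smul_eq_mul]) (by simp [hφ])
  simp only [coe_comp, Function.comp_apply, mulLeft_apply, mulRight_apply] at hs ht
  let f : WithConv (H →ₗ[K] K) :=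
    toConv (φ - φ (d 0) • (X 0).ofConv - φ (d 1) • (X 1).ofConv)
  have hf : ∀ y, f y = φ y - φ (d 0) * X 0 y - φ (d 1) * X 1 y := fun y => rfl
  have hdec : ∀ y, y = X 0 y • d 0 + X 1 y • d 1 + f y • x := by
    intro y
    have h0 : π (y - X 0 y • d 0 - X 1 y • d 1) = 0 := by
      ext i
      have h := fun j => hd i j
      simp only [hXπ] at h
      fin_cases i <;> simp [hXπ] at h ⊢ <;> simp [h]
    have h1 := hφJ _ h0
    have h2 : φ (y - X 0 y • d 0 - X 1 y • d 1) = f y := by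
      rw [hf]
      simp only [map_sub, map_smul, smul_eq_mul]
      ring
    rw [h2] at h1
    rw [h1]
    abel
  have hrad : ∀ i, X i x = 0 := fun i => by rw [hXπ, hxπ]; rfl
  have hlx : ∀ y, y * x = X s y • x := fun y => by rw [← hs, hL]
  have hxl : ∀ y, x * y = X t y • x := fun y => by rw [← ht, hR]
  have hdd : ∀ i j, d i * d j = if i = j then d i else 0 := by
    intro i j
    fin_cases i <;> fin_cases j <;> simp [d, mul_sub, sub_mul, hpp]
  refine ⟨X, d, f, s, t, hX, hrad, ?_, ?_, ?_, hlx, hxl, ?_⟩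
  · simp [hf, hrad, hφ]
  · intro i
    fin_cases i <;> simp [hf, hd]
  · intro g
    ext y
    conv_lhs => rw [hdec y]
    simp [mul_comm]
  · intro u v
    have h1 : f (u * v) • x = (X s u * f v + f u * X t v) • x := by
      have h2 := hdec (u * v)
      have h3 : u * v = (X 0 u * X 0 v) • d 0 + (X 1 u * X 1 v) • d 1 +
          (X s u * f v + f u * X t v) • x := by
        have hu : u * v = (u - f u • x) * (v - f v • x) + u * (f v • x) + (f u • x) * v := by
          simp only [mul_sub, sub_mul, smul_mul_smul_comm, hxx, smul_zero]
          abel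
        have hu' : u - f u • x = X 0 u • d 0 + X 1 u • d 1 := by
          rw [sub_eq_iff_eq_add]; exact hdec u
        have hv' : v - f v • x = X 0 v • d 0 + X 1 v • d 1 := by
          rw [sub_eq_iff_eq_add]; exact hdec v
        rw [hu, hu', hv', mul_smul_comm, smul_mul_assoc, hlx, hxl]
        simp only [add_mul, mul_add, smul_mul_smul_comm, hdd]
        simp
        module
      rw [← hmul 0 u v, ← hmul 1 u v] at h3
      have h4 := h2.symm.trans h3
      exact add_left_cancel h4
    exact smul_left_injective K hx0 h1

/-- A three-dimensional weak Hopf algebra in characteristic zero is, as an algebra, the product of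
three copies of the field. -/
theorem exists_basis_orthogonal {K H : Type*} [Field K] [IsAlgClosed K] [CharZero K] [Ring H]
    [WeakHopfAlgebra K H] (hdim : Module.finrank K H = 3) :
    ∃ b : Module.Basis (Fin 3) K H, ∀ i j, b i * b j = if i = j then b i else 0 := by
  have : FiniteDimensional K H := Module.finite_of_finrank_eq_succ hdim
  have : Nontrivial H := Module.nontrivial_of_finrank_eq_succ hdim
  obtain ⟨n, π, hπ, hnil⟩ := exists_algHom_pi_of_finrank_le_three hdim.le
  have hrank := LinearMap.finrank_range_add_finrank_ker π.toLinearMap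
  rw [LinearMap.range_eq_top.2 hπ, finrank_top, Module.finrank_fin_fun, hdim] at hrank
  have hn : n ≤ 3 := by omega
  interval_cases n
  · have h1 : (RingHom.ker π : Ideal H) = ⊤ := by
      rw [Ideal.eq_top_iff_one, RingHom.mem_ker]
      exact Subsingleton.elim _ _
    obtain ⟨N, hN⟩ := hnil
    have h2 := Ideal.pow_mem_pow (I := RingHom.ker π) (x := (1 : H)) (by rw [h1]; trivial) N
    rw [hN, one_pow] at h2
    exact absurd ((Submodule.mem_bot H).1 h2) one_ne_zero
  · have hbot := eq_bot_of_local (J := RingHom.ker π)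
      (X := toConv (LinearMap.proj 0 ∘ₗ π.toLinearMap)) (by simp) (by simp)
      (fun z => by
        rw [RingHom.mem_ker]
        simp [funext_iff, Fin.forall_fin_one]) hnil
    have h0 : LinearMap.ker π.toLinearMap = ⊥ := by
      rw [Submodule.eq_bot_iff]
      intro z hz
      have : z ∈ (RingHom.ker π : Ideal H) := hz
      rw [hbot] at this
      exact (Submodule.mem_bot H).1 this
    rw [h0, finrank_bot] at hrank
    omega
  · have h1 : Module.finrank K (LinearMap.ker π.toLinearMap) = 1 := by omega
    obtain ⟨⟨x, hxπ⟩, hx0, hx⟩ := finrank_eq_one_iff'.1 h1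
    obtain ⟨N, hN⟩ := hnil
    have h2 := Ideal.pow_mem_pow (I := RingHom.ker π) (x := x) hxπ N
    rw [hN] at h2
    obtain ⟨X, d, f, s, t, h⟩ := exists_isTwoCharSystem hπ (x := x) (fun h => hx0 (by simp [h])) hxπ
      (fun z hz => by
        obtain ⟨c, hc⟩ := hx ⟨z, hz⟩
        exact ⟨c, congrArg Subtype.val hc⟩) ⟨N, (Submodule.mem_bot H).1 h2⟩
    exact absurd h not_isTwoCharSystem
  · have h0 : LinearMap.ker π.toLinearMap = ⊥ := by
      rw [← Submodule.finrank_eq_zero (R := K)]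
      omega
    let e : H ≃ₐ[K] (Fin 3 → K) := AlgEquiv.ofBijective π ⟨LinearMap.ker_eq_bot.1 h0, hπ⟩
    refine ⟨(Pi.basisFun K (Fin 3)).map e.symm.toLinearEquiv, fun i j => ?_⟩
    apply e.injective
    rw [map_mul]
    ext k
    fin_cases i <;> fin_cases j <;> fin_cases k <;> simp

/-! ### Uniqueness of the antipode -/

section Antipode

variable {K A B : Type*} [Field K] [Ring A] [Ring B] [WeakHopfAlgebra K A] [WeakHopfAlgebra K B]

theorem antipode_conv_id_conv_antipode :
    toConv (antipode K) * toConv (LinearMap.id : A →ₗ[K] A) * toConv (antipode K) =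
      toConv (antipode K) := by
  ext x
  refine Eq.trans ?_ (antipode_mul_id_mul_antipode (R := K) x)
  rw [convMul_apply]
  generalize Coalgebra.comul (R := K) x = s
  induction s with
  | zero => simp
  | add s s' h h' => simp only [map_add, h, h']
  | tmul y z => simp

/-- A linear map compatible with the multiplications and comultiplications of two weak Hopf
algebras is compatible with their antipodes. -/
theorem map_antipode_of_bialgEquiv (F : A ≃ₐc[K] B) (x : A) :
    F (antipode K x) = antipode K (F x) := by
  let Fa : A →ₐ[K] B := (F : A ≃ₐ[K] B).toAlgHom
  let Fc : A →ₗc[K] B := F.toCoalgEquiv.toCoalgHom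
  let m : WithConv (A →ₗ[K] B) := toConv Fa.toLinearMap
  let p : WithConv (A →ₗ[K] B) := toConv (Fa.toLinearMap ∘ₗ antipode K)
  let q : WithConv (A →ₗ[K] B) := toConv (antipode K ∘ₗ Fc.toLinearMap)
  have hone : Coalgebra.comul (R := K) (1 : B) =
      TensorProduct.map Fa.toLinearMap Fa.toLinearMap (Coalgebra.comul (R := K) (1 : A)) := by
    have := LinearMap.congr_fun Fc.map_comp_comul 1
    refine Eq.trans ?_ this.symm
    exact congrArg _ (map_one Fa).symm
  have hcounit : ∀ a, Coalgebra.counit (R := K) (Fa a) = Coalgebra.counit (R := K) a :=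
    fun a => LinearMap.congr_fun Fc.counit_comp a
  -- Both sides are governed by the axiom for `id * S`, whose right-hand side involves only `Δ(1)`,
  -- `ε` and the product, all preserved by `F`.
  have hmp : m * p = m * q := by
    have h1 : m * p = toConv (Fa.toLinearMap ∘ₗ
        (toConv (LinearMap.id : A →ₗ[K] A) * toConv (antipode K)).ofConv) := by
      rw [algHom_comp_convMul_distrib]
      rfl
    have h2 : m * q = toConv ((toConv (LinearMap.id : B →ₗ[K] B) * toConv (antipode K)).ofConv ∘ₗ
        Fc.toLinearMap) := by
      rw [convMul_comp_coalgHom_distrib]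
      rfl
    rw [h1, h2]
    ext y
    have h3 := mul_antipode_lTensor (R := K) y
    have h4 := mul_antipode_lTensor (R := K) (Fa y)
    refine (congrArg Fa h3).trans (Eq.trans ?_ h4.symm)
    rw [hone]
    generalize Coalgebra.comul (R := K) (1 : A) = s
    induction s with
    | zero => simp
    | add s s' h h' => simp only [add_mul, map_add, h, h']
    | tmul a b => simp [← map_mul, hcounit]
  have hpm : p * m = q * m := by
    have h1 : p * m = toConv (Fa.toLinearMap ∘ₗ
        (toConv (antipode K) * toConv (LinearMap.id : A →ₗ[K] A)).ofConv) := by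
      rw [algHom_comp_convMul_distrib]
      rfl
    have h2 : q * m = toConv ((toConv (antipode K) * toConv (LinearMap.id : B →ₗ[K] B)).ofConv ∘ₗ
        Fc.toLinearMap) := by
      rw [convMul_comp_coalgHom_distrib]
      rfl
    rw [h1, h2]
    ext y
    have h3 := mul_antipode_rTensor (R := K) y
    have h4 := mul_antipode_rTensor (R := K) (Fa y)
    refine (congrArg Fa h3).trans (Eq.trans ?_ h4.symm)
    rw [hone]
    generalize Coalgebra.comul (R := K) (1 : A) = s
    induction s with
    | zero => simp
    | add s s' h h' => simp only [mul_add, map_add, h, h']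
    | tmul a b => simp [← map_mul, hcounit]
  have hpmp : p * m * p = p := by
    have h1 := congrArg (fun g : WithConv (A →ₗ[K] A) => toConv (Fa.toLinearMap ∘ₗ g.ofConv))
      (antipode_conv_id_conv_antipode (K := K) (A := A))
    simp only [algHom_comp_convMul_distrib] at h1
    exact h1
  have hqmq : q * m * q = q := by
    have h1 := congrArg (fun g : WithConv (B →ₗ[K] B) => toConv (g.ofConv ∘ₗ Fc.toLinearMap))
      (antipode_conv_id_conv_antipode (K := K) (A := B))
    simp only [convMul_comp_coalgHom_distrib] at h1
    exact h1
  -- Uniqueness of a generalized inverse: `p = p m p = q m p = q m q = q`.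
  have hpq : p = q := by
    rw [← hpmp, hpm, mul_assoc, hmp, ← mul_assoc, hqmq]
  exact LinearMap.congr_fun (congrArg ofConv hpq) x

end Antipode

/-! ### Coordinates of a basis of orthogonal idempotents -/

section Basis

variable {K H : Type*} [Field K] [Ring H] [WeakHopfAlgebra K H]

/-- The values of `Δ` on a basis in terms of the convolution products of the coordinates. -/
theorem comul_basis {ι : Type*} [Fintype ι] (b : Module.Basis ι K H) (k : ι) :
    Coalgebra.comul (R := K) (b k) =
      ∑ i, ∑ j, (toConv (b.coord i) * toConv (b.coord j)) (b k) • (b i ⊗ₜ[K] b j) := by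
  simp only [convMul_apply]
  generalize Coalgebra.comul (R := K) (b k) = s
  induction s with
  | zero => simp
  | add s s' h h' =>
    simp only [map_add, add_smul, Finset.sum_add_distrib]
    rw [← h, ← h']
  | tmul x y =>
    conv_lhs => rw [← b.sum_repr x, ← b.sum_repr y]
    simp only [TensorProduct.sum_tmul, TensorProduct.tmul_sum, TensorProduct.smul_tmul_smul]
    rw [Finset.sum_comm]
    simp

theorem isCharSystem_coord {ι : Type*} [Fintype ι] [DecidableEq ι] {b : Module.Basis ι K H}
    (hb : ∀ i j, b i * b j = if i = j then b i else 0) :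
    IsCharSystem (fun i => toConv (b.coord i)) b := by
  refine ⟨fun i x y => ?_, fun i j => ?_, fun z hz => ?_⟩
  · have hxy : x * y = ∑ k, (b.repr x k * b.repr y k) • b k := by
      conv_lhs => rw [← b.sum_repr x, ← b.sum_repr y]
      simp only [Finset.sum_mul, Finset.mul_sum, smul_mul_smul_comm, hb, smul_ite, smul_zero,
        Finset.sum_ite_eq', Finset.mem_univ, if_true]
    simp [hxy, Finsupp.single_apply]
  · simp [Finsupp.single_apply, eq_comm]
  · have : z = 0 := b.ext_elem fun i => by simpa using hz i
    rw [this]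
    exact IsNilpotent.zero

/-- Supplies the hypothesis on `ε` in the results on character systems, with no extra argument in
the semisimple case. -/
theorem counit_eq_sum_coord {ι : Type*} [Fintype ι] (b : Module.Basis ι K H) :
    (1 : WithConv (H →ₗ[K] K)) =
      ∑ i, (1 : WithConv (H →ₗ[K] K)) (b i) • toConv (b.coord i) := by
  ext y
  conv_lhs => rw [← b.sum_repr y]
  simp

/-- In a split semisimple commutative weak Hopf algebra the coordinates have right inverses. -/
theorem exists_right_inverse_coord {ι : Type*} [Fintype ι] [DecidableEq ι]
    {b : Module.Basis ι K H} (hb : ∀ i j, b i * b j = if i = j then b i else 0) {i k : ι}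
    (hk : (1 : WithConv (H →ₗ[K] K)) (b k) = 1)
    (hki : toConv (b.coord k) * toConv (b.coord i) = toConv (b.coord i)) :
    ∃ j, toConv (b.coord i) * toConv (b.coord j) = toConv (b.coord k) := by
  have hX := isCharSystem_coord hb
  have h := hX.conv_antipode_apply_dual (counit_eq_sum_coord b) hk hki
  set g : WithConv (H →ₗ[K] K) := toConv ((toConv (b.coord i)).ofConv ∘ₗ antipode K)
  have hg : g = ∑ j, g (b j) • toConv (b.coord j) := by
    ext y
    conv_lhs => rw [← b.sum_repr y]
    simp
  rw [hg, Finset.mul_sum, ofConv_sum, LinearMap.sum_apply] at h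
  obtain ⟨j, -, hj⟩ := Finset.exists_ne_zero_of_sum_ne_zero (h.trans_ne one_ne_zero)
  simp only [mul_smul_comm, ofConv_smul, LinearMap.smul_apply] at hj
  have hj' := (smul_ne_zero_iff.1 hj).2
  refine ⟨j, ?_⟩
  rcases hX.mul_eq_zero_or_exists i j with hz | ⟨l, hl⟩
  · simp [hz] at hj'
  · rw [hl, hX.map_dual] at hj'
    rw [hl, ← of_not_not fun hne => hj' (if_neg hne)]

end Basis

/-! ### Multiplication tables of the three-arrow groupoids -/

section Semigroup

variable {D : Type*} [Ring D]

/-- A three-element set containing `1` which is closed under nonzero products and has right inverses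
is a cyclic group. -/
theorem mul_table_of_one_unit {B C : D} (hB : B ≠ 1) (hC : C ≠ 1)
    (hBC : B ≠ C) (hC0 : C ≠ 0) (hbb : B * B = 0 ∨ B * B = 1 ∨ B * B = B ∨ B * B = C)
    (hbc : B * C = 0 ∨ B * C = 1 ∨ B * C = B ∨ B * C = C)
    (hBinv : B * B = 1 ∨ B * C = 1) (hCinv : ∃ y, C * y = 1) :
    B * B = C ∧ B * C = 1 := by
  obtain ⟨y, hy⟩ := hCinv
  have hbc1 : B * C = 1 := by
    rcases hBinv with h | h
    · have h2 : B * (B * C) = C := by rw [← mul_assoc, h, one_mul]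
      rcases hbc with e | e | e | e
      · rw [e, mul_zero] at h2
        exact absurd h2.symm hC0
      · exact e
      · rw [e, h] at h2
        exact absurd h2.symm hC
      · have : B * C * y = C * y := by rw [e]
        rw [mul_assoc, hy, mul_one] at this
        exact absurd this hB
    · exact h
  refine ⟨?_, hbc1⟩
  have h2 : B * B * C = B := by rw [mul_assoc, hbc1, mul_one]
  rcases hbb with e | e | e | e
  · rw [e, zero_mul] at h2
    rw [← h2, zero_mul] at hbc1
    exact absurd (by rw [← mul_one C, ← hbc1, mul_zero]) hC0
  · rw [e, one_mul] at h2
    exact absurd h2.symm hBC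
  · rw [e, hbc1] at h2
    exact absurd h2.symm hB
  · exact e

/-- An endomorphism `C` of the identity `A` in a groupoid with two identities and three arrows is an
involution. -/
theorem mul_table_of_two_units {A B C : D} (hAA : A * A = A) (hAB : A * B = 0) (hBA : B * A = 0)
    (hA : A ≠ 0) (hCA : C ≠ A) (hl : A * C = C) (hr : C * A = C ∨ C * B = C)
    (hinv : C * A = A ∨ C * B = A ∨ C * C = A) :
    B * C = 0 ∧ C * C = A ∧ C * A = C ∧ C * B = 0 := by
  have hBC : B * C = 0 := by rw [← hl, ← mul_assoc, hBA, zero_mul]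
  have hCC : C * C = A := by
    -- A right inverse of `C` that is an identity would give `C = A` or `A = 0`, so it must be `C`
    -- itself.
    rcases hinv with h | h | h
    · rcases hr with h' | h'
      · exact absurd (h'.symm.trans h) hCA
      · rw [← h', mul_assoc, hBA, mul_zero] at h
        exact absurd h.symm hA
    · have h2 : C * B * A = A := by rw [h, hAA]
      rw [mul_assoc, hBA, mul_zero] at h2
      exact absurd h2.symm hA
    · exact h
  have hCA' : C * A = C := by
    rcases hr with h | h
    · exact h
    · have h2 : C * C * B = C * C := by rw [mul_assoc, h]
      rw [hCC, hAB] at h2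
      exact absurd h2.symm hA
  exact ⟨hBC, hCC, hCA', by rw [← hCA', mul_assoc, hAB, mul_zero]⟩

end Semigroup

/-! ### Identification with the listed structures -/

section Classification

variable {K H : Type*} [Field K] [Ring H] [WeakHopfAlgebra K H]

/-- The isomorphism sending a basis of orthogonal idempotents to the idempotents `d` of a listed
weak Hopf algebra. -/
theorem nonempty_weakHopfIso {b : Module.Basis (Fin 3) K H}
    (hb : ∀ i j, b i * b j = if i = j then b i else 0) {l : Fin 3}
    (hε : ∀ k, Coalgebra.counit (R := K) (b k) = ListedWHA.counitTableD K l k)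
    (hΔ : ∀ F : H →ₗ[K] ListedWHA K l, (∀ i, F (b i) = ListedWHA.d K l i) → ∀ k,
      TensorProduct.map F F (Coalgebra.comul (R := K) (b k)) = ListedWHA.comulTableD K l k) :
    Nonempty (WeakHopfIso K H (ListedWHA K l)) := by
  let F : H →ₗ[K] ListedWHA K l := b.constr K (ListedWHA.d K l)
  have hF : ∀ i, F (b i) = ListedWHA.d K l i := b.constr_basis K _
  let G : ListedWHA K l →ₗ[K] H := (ListedWHA.e K l).constr K ![b 0 + b 1 + b 2, b 1 + b 2, b 2]
  have hG : ∀ i, G (ListedWHA.e K l i) = ![b 0 + b 1 + b 2, b 1 + b 2, b 2] i :=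
    (ListedWHA.e K l).constr_basis K _
  have hFG : F ∘ₗ G = LinearMap.id := by
    refine (ListedWHA.e K l).ext fun i => ?_
    rw [comp_apply, hG]
    fin_cases i <;> simp [hF, ListedWHA.e_zero, ListedWHA.e_one, ListedWHA.e_two]
  have hGF : G ∘ₗ F = LinearMap.id := by
    refine b.ext fun i => ?_
    rw [comp_apply, hF]
    fin_cases i <;> simp [hG, ListedWHA.d]
  have hmul : ∀ x y, F (x * y) = F x * F y := by
    intro x y
    have h : F ∘ₗ LinearMap.mul' K H = LinearMap.mul' K _ ∘ₗ TensorProduct.map F F := by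
      refine (b.tensorProduct b).ext fun ⟨i, j⟩ => ?_
      simp only [Module.Basis.tensorProduct_apply, comp_apply, mul'_apply, TensorProduct.map_tmul,
        hb, hF, ListedWHA.d_mul_d]
      split_ifs
      · exact hF i
      · exact map_zero F
    exact LinearMap.congr_fun h (x ⊗ₜ[K] y)
  let L : H ≃ₗ[K] ListedWHA K l := LinearEquiv.ofLinearMap F G hFG hGF
  let E : H ≃ₐc[K] ListedWHA K l :=
    { L with
      counit_comp := by
        refine b.ext fun k => ?_
        refine Eq.trans ?_ (hε k).symm
        rw [← ListedWHA.counit_d, ← hF]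
        rfl
      map_comp_comul := by
        refine b.ext fun k => ?_
        refine (hΔ F hF k).trans ?_
        rw [← ListedWHA.comul_d, ← hF]
        rfl
      map_mul' := hmul }
  exact ⟨{ E with map_antipode := map_antipode_of_bialgEquiv E }⟩

/-- One identity: the coordinates form a group of order 3, necessarily cyclic, and `Δ` is dual to
its table. -/
theorem nonempty_weakHopfIso_zero {b : Module.Basis (Fin 3) K H}
    (hb : ∀ i j, b i * b j = if i = j then b i else 0)
    (h0 : (1 : WithConv (H →ₗ[K] K)) (b 0) = 1) (h1 : (1 : WithConv (H →ₗ[K] K)) (b 1) = 0)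
    (h2 : (1 : WithConv (H →ₗ[K] K)) (b 2) = 0) :
    Nonempty (WeakHopfIso K H (ListedWHA K 0)) := by
  have hX := isCharSystem_coord hb
  have hone : toConv (b.coord 0) = 1 := by
    rw [counit_eq_sum_coord b, Fin.sum_univ_three, h0, h1, h2]
    simp
  have hinv : ∀ i, ∃ j, toConv (b.coord i) * toConv (b.coord j) = 1 := fun i => by
    rw [← hone]
    exact exists_right_inverse_coord hb h0 (by rw [hone, one_mul])
  have hclosed : ∀ i j k l : Fin 3, (∀ m, m = 0 ∨ m = k ∨ m = l) →
      toConv (b.coord i) * toConv (b.coord j) = 0 ∨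
      toConv (b.coord i) * toConv (b.coord j) = 1 ∨
      toConv (b.coord i) * toConv (b.coord j) = toConv (b.coord k) ∨
      toConv (b.coord i) * toConv (b.coord j) = toConv (b.coord l) := by
    intro i j k l hkl
    rcases hX.mul_eq_zero_or_exists i j with hz | ⟨m, hm⟩
    · exact Or.inl hz
    · rcases hkl m with rfl | rfl | rfl
      · exact Or.inr (Or.inl (hm.trans hone))
      · exact Or.inr (Or.inr (Or.inl hm))
      · exact Or.inr (Or.inr (Or.inr hm))
  have hne : ∀ i j, i ≠ j → toConv (b.coord i) ≠ toConv (b.coord j) :=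
    fun i j hij h => hij (hX.injective h)
  have htable : ∀ i j : Fin 3, i ≠ 0 → j ≠ 0 → i ≠ j →
      toConv (b.coord i) * toConv (b.coord i) = toConv (b.coord j) ∧
      toConv (b.coord i) * toConv (b.coord j) = 1 := by
    intro i j hi hj hij
    have hex : ∀ m, m = 0 ∨ m = i ∨ m = j := by omega
    refine mul_table_of_one_unit (hone ▸ hne i 0 hi) (hone ▸ hne j 0 hj) (hne i j hij)
      (hX.ne_zero j) (hclosed i i i j hex) (hclosed i j i j hex) ?_ ((hinv j).imp' _ fun _ h => h)
    obtain ⟨m, hm⟩ := hinv i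
    rcases hex m with rfl | rfl | rfl
    · rw [hone, mul_one] at hm
      exact absurd (hm.trans hone.symm) (hne i 0 hi)
    · exact Or.inl hm
    · exact Or.inr hm
  obtain ⟨e11, e12⟩ := htable 1 2 (by decide) (by decide) (by decide)
  obtain ⟨e22, e21⟩ := htable 2 1 (by decide) (by decide) (by decide)
  rw [← hone] at e12 e21
  have hl : ∀ i, toConv (b.coord 0) * toConv (b.coord i) = toConv (b.coord i) :=
    fun i => by rw [hone, one_mul]
  have hr : ∀ i, toConv (b.coord i) * toConv (b.coord 0) = toConv (b.coord i) :=
    fun i => by rw [hone, mul_one]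
  refine nonempty_weakHopfIso hb (fun k => ?_) fun F hF k => ?_
  · fin_cases k
    exacts [h0, h1, h2]
  · rw [comul_basis]
    simp only [Fin.sum_univ_three, hl, hr, e11, e12, e22, e21, Module.Basis.coord_apply,
      Module.Basis.repr_self, Finsupp.single_apply]
    fin_cases k <;> simp [hF, ListedWHA.comulTableD]
    abel

/-- Two identities: the third arrow starts and ends at its left unit, here index 1, and is an
involution there. -/
theorem nonempty_weakHopfIso_one {b : Module.Basis (Fin 3) K H}
    (hb : ∀ i j, b i * b j = if i = j then b i else 0)
    (h0 : (1 : WithConv (H →ₗ[K] K)) (b 0) = 1) (h1 : (1 : WithConv (H →ₗ[K] K)) (b 1) = 1)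
    (h2 : (1 : WithConv (H →ₗ[K] K)) (b 2) = 0)
    (hl : toConv (b.coord 1) * toConv (b.coord 2) = toConv (b.coord 2)) :
    Nonempty (WeakHopfIso K H (ListedWHA K 1)) := by
  have hX := isCharSystem_coord hb
  have hα := counit_eq_sum_coord b
  have e00 := ((hX.coeff_eq_zero_or_one hα 0).resolve_left (by simp [h0])).2
  have e11 := ((hX.coeff_eq_zero_or_one hα 1).resolve_left (by simp [h1])).2
  have e01 := hX.mul_eq_zero_of_ne hα (i := 0) (j := 1) (by decide) (by simp [h0]) (by simp [h1])
  have e10 := hX.mul_eq_zero_of_ne hα (i := 1) (j := 0) (by decide) (by simp [h1]) (by simp [h0])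
  have hr : toConv (b.coord 2) * toConv (b.coord 1) = toConv (b.coord 2) ∨
      toConv (b.coord 2) * toConv (b.coord 0) = toConv (b.coord 2) := by
    obtain ⟨k, hk, hk'⟩ := hX.exists_right_unit hα 2
    rcases (show k = 0 ∨ k = 1 ∨ k = 2 by omega) with rfl | rfl | rfl
    · exact Or.inr hk'
    · exact Or.inl hk'
    · exact absurd (h2.symm.trans hk) zero_ne_one
  have hinv : toConv (b.coord 2) * toConv (b.coord 1) = toConv (b.coord 1) ∨
      toConv (b.coord 2) * toConv (b.coord 0) = toConv (b.coord 1) ∨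
      toConv (b.coord 2) * toConv (b.coord 2) = toConv (b.coord 1) := by
    obtain ⟨k, hk⟩ := exists_right_inverse_coord hb h1 hl
    rcases (show k = 0 ∨ k = 1 ∨ k = 2 by omega) with rfl | rfl | rfl
    exacts [Or.inr (Or.inl hk), Or.inl hk, Or.inr (Or.inr hk)]
  obtain ⟨e02, e22, e21, e20⟩ := mul_table_of_two_units e11 e10 e01 (hX.ne_zero 1)
    (fun h => absurd (hX.injective h) (by decide)) hl hr hinv
  refine nonempty_weakHopfIso hb (fun k => ?_) fun F hF k => ?_
  · fin_cases k
    exacts [h0, h1, h2]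
  · rw [comul_basis]
    simp only [Fin.sum_univ_three, e00, e01, e02, e10, e11, hl, e20, e21, e22,
      Module.Basis.coord_apply, Module.Basis.repr_self, Finsupp.single_apply]
    fin_cases k <;> simp [hF, ListedWHA.comulTableD]

theorem nonempty_weakHopfIso_two {b : Module.Basis (Fin 3) K H}
    (hb : ∀ i j, b i * b j = if i = j then b i else 0)
    (h : ∀ i, (1 : WithConv (H →ₗ[K] K)) (b i) = 1) :
    Nonempty (WeakHopfIso K H (ListedWHA K 2)) := by
  have hX := isCharSystem_coord hb
  have hα := counit_eq_sum_coord b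
  have e : ∀ i j, toConv (b.coord i) * toConv (b.coord j) =
      if i = j then toConv (b.coord i) else 0 := by
    intro i j
    by_cases hij : i = j
    · subst hij
      rw [if_pos rfl]
      exact ((hX.coeff_eq_zero_or_one hα i).resolve_left (by simp [h])).2
    · rw [if_neg hij]
      exact hX.mul_eq_zero_of_ne hα hij (by simp [h]) (by simp [h])
  refine nonempty_weakHopfIso hb (fun k => ?_) fun F hF k => ?_
  · refine (h k).trans ?_
    fin_cases k <;> rfl
  · rw [comul_basis]
    simp only [Fin.sum_univ_three, e]
    fin_cases k <;> simp [hF, ListedWHA.comulTableD]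

theorem exists_weakHopfIso_of_basis {b : Module.Basis (Fin 3) K H}
    (hb : ∀ i j, b i * b j = if i = j then b i else 0) :
    ∃ l : Fin 3, Nonempty (WeakHopfIso K H (ListedWHA K l)) := by
  have hα := counit_eq_sum_coord b
  have hX := isCharSystem_coord hb
  have hone : ∀ i, (1 : WithConv (H →ₗ[K] K)) (b i) = 0 ∨ (1 : WithConv (H →ₗ[K] K)) (b i) = 1 :=
    fun i => (hX.coeff_eq_zero_or_one hα i).imp_right And.left
  have hre : ∀ σ : Equiv.Perm (Fin 3), ∀ i j, b.reindex σ i * b.reindex σ j =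
      if i = j then b.reindex σ i else 0 := fun σ i j => by simp [hb]
  have hc : ∀ (σ : Equiv.Perm (Fin 3)) (i : Fin 3),
      (b.reindex σ).coord i = b.coord (σ.symm i) := fun σ i => by ext; simp
  have hcase0 : ∀ i : Fin 3, (1 : WithConv (H →ₗ[K] K)) (b i) = 1 →
      (∀ j, j ≠ i → (1 : WithConv (H →ₗ[K] K)) (b j) = 0) →
      ∃ l : Fin 3, Nonempty (WeakHopfIso K H (ListedWHA K l)) := by
    intro i hi hj
    have hv : ∀ k, k ≠ 0 → (1 : WithConv (H →ₗ[K] K)) (b.reindex (Equiv.swap 0 i) k) = 0 := by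
      intro k hk
      rw [Module.Basis.reindex_apply, Equiv.symm_swap]
      exact hj _ fun h => hk (by
        rw [← Equiv.swap_apply_self 0 i k, h, Equiv.swap_apply_right])
    exact ⟨0, nonempty_weakHopfIso_zero (hre (Equiv.swap 0 i))
      (by rw [Module.Basis.reindex_apply, Equiv.symm_swap, Equiv.swap_apply_left, hi])
      (hv 1 (by decide)) (hv 2 (by decide))⟩
  have hcase1 : ∀ σ : Equiv.Perm (Fin 3), (1 : WithConv (H →ₗ[K] K)) (b (σ 0)) = 1 →
      (1 : WithConv (H →ₗ[K] K)) (b (σ 1)) = 1 → (1 : WithConv (H →ₗ[K] K)) (b (σ 2)) = 0 →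
      ∃ l : Fin 3, Nonempty (WeakHopfIso K H (ListedWHA K l)) := by
    intro σ h0 h1 h2
    obtain ⟨k, hk, hk'⟩ := hX.exists_left_unit hα (σ 2)
    -- The left unit of the non-identity arrow may be either identity; if it is `σ 0`, the two
    -- identities are swapped so that it gets index 1.
    obtain ⟨m, rfl⟩ := σ.surjective k
    rcases (show m = 0 ∨ m = 1 ∨ m = 2 by omega) with rfl | rfl | rfl
    · refine ⟨1, nonempty_weakHopfIso_one (hre ((Equiv.swap 0 1).trans σ).symm) ?_ ?_ ?_ ?_⟩
      · simpa using h1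
      · simpa using h0
      · simpa [Equiv.swap_apply_of_ne_of_ne] using h2
      · simpa [hc, Equiv.swap_apply_of_ne_of_ne] using hk'
    · refine ⟨1, nonempty_weakHopfIso_one (hre σ.symm) ?_ ?_ ?_ ?_⟩
      · simpa using h0
      · simpa using h1
      · simpa using h2
      · simpa [hc] using hk'
    · exact absurd (h2.symm.trans hk) zero_ne_one
  rcases hone 0 with h0 | h0 <;> rcases hone 1 with h1 | h1 <;> rcases hone 2 with h2 | h2
  · obtain ⟨k, hk, -⟩ := hX.exists_left_unit hα 0
    refine absurd hk ?_
    rcases (show k = 0 ∨ k = 1 ∨ k = 2 by omega) with rfl | rfl | rfl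
    · rw [h0]; exact zero_ne_one
    · rw [h1]; exact zero_ne_one
    · rw [h2]; exact zero_ne_one
  · refine hcase0 2 h2 fun j hj => ?_
    rcases (show j = 0 ∨ j = 1 by omega) with rfl | rfl
    exacts [h0, h1]
  · refine hcase0 1 h1 fun j hj => ?_
    rcases (show j = 0 ∨ j = 2 by omega) with rfl | rfl
    exacts [h0, h2]
  · exact hcase1 (Equiv.swap 0 2) (by simpa using h2)
      (by simpa [Equiv.swap_apply_of_ne_of_ne] using h1) (by simpa using h0)
  · refine hcase0 0 h0 fun j hj => ?_
    rcases (show j = 1 ∨ j = 2 by omega) with rfl | rfl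
    exacts [h1, h2]
  · exact hcase1 (Equiv.swap 1 2) (by simpa [Equiv.swap_apply_of_ne_of_ne] using h0)
      (by simpa using h2) (by simpa using h1)
  · exact hcase1 1 (by simpa using h0) (by simpa using h1) (by simpa using h2)
  · refine ⟨2, nonempty_weakHopfIso_two hb fun i => ?_⟩
    rcases (show i = 0 ∨ i = 1 ∨ i = 2 by omega) with rfl | rfl | rfl
    exacts [h0, h1, h2]

theorem counit_one_eq_of_weakHopfIso {l : Fin 3} (F : WeakHopfIso K H (ListedWHA K l)) :
    Coalgebra.counit (R := K) (1 : H) = ((l : ℕ) : K) + 1 := by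
  have h1 : Coalgebra.counit (R := K) (F.toBialgEquiv (1 : H)) =
      Coalgebra.counit (R := K) (1 : H) :=
    LinearMap.congr_fun F.toBialgEquiv.toCoalgEquiv.toCoalgHom.counit_comp 1
  rw [← h1, map_one F.toBialgEquiv, ListedWHA.one_eq]
  refine (ListedWHA.counit_e 0).trans ?_
  fin_cases l <;> simp [ListedWHA.counitTable] <;> norm_num

end Classification

end WeakHopfAlgebra

/-- Classification of the 3-dimensional weak Hopf algebras over an algebraically closed field of
characteristic zero: each is isomorphic to one, and only one, of the three listed ones. -/
theorem proposition4p6 {K : Type*} [Field K] [IsAlgClosed K] [CharZero K]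
    (H : Type*) [Ring H] [WeakHopfAlgebra K H] (hdim : Module.finrank K H = 3) :
    ∃! i : Fin 3, Nonempty (WeakHopfIso K H (ListedWHA K i)) := by
  obtain ⟨b, hb⟩ := WeakHopfAlgebra.exists_basis_orthogonal hdim
  obtain ⟨i, hi⟩ := WeakHopfAlgebra.exists_weakHopfIso_of_basis hb
  refine ⟨i, hi, ?_⟩
  rintro j ⟨G⟩
  obtain ⟨F⟩ := hi
  have h := (WeakHopfAlgebra.counit_one_eq_of_weakHopfIso G).symm.trans
    (WeakHopfAlgebra.counit_one_eq_of_weakHopfIso F)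
  exact Fin.ext (Nat.cast_injective (add_right_cancel h))
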